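/- Let $A=\{a,b\}$, let $A^*$ be the free monoid of all words over $A$ (with empty word $\varepsilon$), and let $K$ be a field. **Thompson groups.** A right ideal of $A^*$ is a set $R\subseteq A^*$ with $RA^*\subseteq R$; it is *essential* if it meets every nonempty right ideal. A *prefix code* is a set of words none of which is a strict prefix of another; a prefix code is *maximal* if it is not a strict subset of a prefix code. Every right ideal is $PA^*$ for exactly one prefix code $P$; it is *finitely generated* if $P$ is finite. An isomorphism between right ideals $R_1,R_2$ is a bijection $\varphi:R_1\to R_2$ with $\varphi(ux)=\varphi(u)x$ for all $u\in R_1$, $x\in A^*$; it is *maximal* if it has no strict extension to an isomorphism between right ideals. Every isomorphism $\varphi$ between essential right ideals has a unique maximal extension $\max\varphi$. The Thompson group $\mathcal G_{2,1}$ is the set of all maximal isomorphisms between essential right ideals of $A^*$, with product $\varphi\cdot\psi=\max(\varphi\circ\psi)$ (where $\psi$ is applied first); the Thompson group $V$ is its subgroup of all maximal isomorphisms between finitely generated essential right ideals. **The algebra $\mathcal C_V$.** The polycyclic monoid $PC(a,b)$ is the inverse monoid with zero presented by the generators $a,b$ and the relations $a^{-1}a=b^{-1}b=1$, $a^{-1}b=b^{-1}a=0$;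 its nonzero elements are the $yx^{-1}$ with $y,x\in A^*$, and $(y,x)$ is determined by $yx^{-1}$. Let $K[PC(a,b)]$ be the algebra of the finite sums $\sum\kappa_i y_ix_i^{-1}$, that is, the monoid algebra of $PC(a,b)$ over $K$ in which the zero of the monoid is identified with the zero of the algebra. Let $I_V$ be its two-sided ideal generated by $aa^{-1}+bb^{-1}-1$, and let $\mathcal C_V=K[PC(a,b)]/I_V$. Let $\mathcal U_V\subset K[PC(a,b)]$ be the set of all sums $\sum_{i\in I}y_ix_i^{-1}$ where $I$ is finite and $i\mapsto x_i$ and $i\mapsto y_i$ are bijections from $I$ onto maximal prefix codes, and let $\mathcal U_V/I_V$ be the image of $\mathcal U_V$ in $\mathcal C_V$. **The algebra $\mathcal C_\infty$.** Let $\mathcal B_\infty$ be the algebra of all (possibly infinite) formal sums $\sum_{y,x\in A^*}\kappa_{y,x}\,yx^{-1}$ with $\kappa_{y,x}\in K$ such that for every $y$ there are only finitely many $x$, and for every $x$ only finitely many $y$, with $\kappa_{y,x}\ne0$; sums are multiplied by means of the product of $PC(a,b)$, each coefficient of a product being a finite sum. Let $\mathcal U_\infty\subset\mathcal B_\infty$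 be the set of all sums $\sum_{i\in I}y_ix_i^{-1}$, $I\subseteq\mathbb N$, such that $i\mapsto x_i$ and $i\mapsto y_i$ are bijections from $I$ onto maximal prefix codes, and let $\mathcal U_\infty^{\rm part}$ be defined in the same way with (not necessarily maximal) prefix codes. Let $\mathcal A_\infty$ be the subalgebra of $\mathcal B_\infty$ generated by $\mathcal U_\infty^{\rm part}$. Let $I_\infty$ be the two-sided ideal of $\mathcal A_\infty$ generated by all the sums $$\sum_{i\in I}y_i\Big(\sum_{q\in Q_i}qq^{-1}-1\Big)x_i^{-1},$$ where $I\subseteq\mathbb N$, $i\mapsto x_i$ and $i\mapsto y_i$ are bijections from $I$ onto maximal prefix codes, and every $Q_i$ is a maximal prefix code. Let $\mathcal C_\infty=\mathcal A_\infty/I_\infty$, and let $\mathcal U_\infty/I_\infty$ be the image of $\mathcal U_\infty$ in $\mathcal C_\infty$. **Theorem.** (1) The set $\mathcal U_V/I_V$ is a subgroup of the group of units of $\mathcal C_V$, and this group is isomorphic to $V$. (2) The set $\mathcal U_\infty/I_\infty$ is a subgroup of the group of units of $\mathcal C_\infty$, and this group is isomorphic to $\mathcal G_{2,1}$. -/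

import Mathlib

/-- The two-letter alphabet `A = {a, b}`. -/
inductive Letter
  | a
  | b
  deriving DecidableEq

instance : Fintype Letter := ⟨{Letter.a, Letter.b}, by intro x; cases x <;> decide⟩

/-- The free monoid `A* = {a, b}*`; the product of words is concatenation `++`. -/
abbrev Word := List Letter

namespace Thompson

/-! ### Right ideals and prefix codes of `{a, b}*` -/

/-- `R` is a right ideal: `R · A* ⊆ R`. -/
def IsRightIdeal (R : Set Word) : Prop := ∀ u ∈ R, ∀ x : Word, u ++ x ∈ R

/-- `R` is an essential right ideal: it meets every (nonempty) right ideal. -/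
def IsEssential (R : Set Word) : Prop :=
  IsRightIdeal R ∧ ∀ J : Set Word, IsRightIdeal J → J.Nonempty → (R ∩ J).Nonempty

/-- A prefix code: no element is a strict prefix of another element. -/
def IsPrefixCode (C : Set Word) : Prop := ∀ u ∈ C, ∀ v ∈ C, u <+: v → u = v

/-- A maximal prefix code: a prefix code that is not a strict subset of a prefix code. -/
def IsMaximalPrefixCode (C : Set Word) : Prop :=
  IsPrefixCode C ∧ ∀ D : Set Word, IsPrefixCode D → C ⊆ D → C = D

/-- `P · A*`. -/
def generatedBy (P : Set Word) : Set Word := {w | ∃ p ∈ P, ∃ x : Word, w = p ++ x}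

/-- The right ideal `R` is finitely generated: its prefix code is finite. -/
def IsFinGen (R : Set Word) : Prop := ∃ P : Set Word, IsPrefixCode P ∧ P.Finite ∧ R = generatedBy P

/-! ### Right-ideal isomorphisms

A partial bijection of `A*` is a `Word ≃. Word`; the relation `φ ≤ Φ` says that `Φ` extends `φ`. -/

/-- The domain of a partial bijection. -/
def dom (φ : Word ≃. Word) : Set Word := {u | ∃ v, v ∈ φ u}

/-- The range of a partial bijection. -/
def ran (φ : Word ≃. Word) : Set Word := {v | ∃ u, v ∈ φ u}

/-- `φ` is an isomorphism between right ideals: its domain and range are right ideals, and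
`φ (u x) = φ (u) x` for all `u` in the domain and all words `x`. -/
structure IsRightIdealIso (φ : Word ≃. Word) : Prop where
  dom_ideal : IsRightIdeal (dom φ)
  ran_ideal : IsRightIdeal (ran φ)
  map_append : ∀ u v : Word, v ∈ φ u → ∀ x : Word, v ++ x ∈ φ (u ++ x)

/-- `φ` is an isomorphism between essential right ideals. -/
structure IsEssentialIso (φ : Word ≃. Word) : Prop extends IsRightIdealIso φ where
  dom_essential : IsEssential (dom φ)
  ran_essential : IsEssential (ran φ)

/-- `φ` is a maximal isomorphism between essential right ideals: it has no strict extension to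
an isomorphism between right ideals. -/
structure IsMaximalIso (φ : Word ≃. Word) : Prop extends IsEssentialIso φ where
  maximal : ∀ Φ : Word ≃. Word, IsRightIdealIso Φ → φ ≤ Φ → Φ = φ

theorem IsEssential.exists_append {R : Set Word} (h : IsEssential R) (u : Word) :
    ∃ x : Word, u ++ x ∈ R := by
  obtain ⟨w, hw, x, rfl⟩ := h.2 {w | ∃ x : Word, w = u ++ x}
    (by rintro _ ⟨x, rfl⟩ y; exact ⟨x ++ y, by simp⟩) ⟨u, [], by simp⟩
  exact ⟨x, hw⟩

theorem isEssential_of_exists {R : Set Word} (hR : IsRightIdeal R)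
    (h : ∀ u : Word, ∃ x : Word, u ++ x ∈ R) : IsEssential R := by
  refine ⟨hR, fun J hJ ⟨u, hu⟩ => ?_⟩
  obtain ⟨x, hx⟩ := h u
  exact ⟨u ++ x, hx, hJ u hu x⟩

theorem dom_symm (φ : Word ≃. Word) : dom φ.symm = ran φ := by
  ext v; simp [dom, ran, ← PEquiv.mem_iff_mem φ]

theorem ran_symm (φ : Word ≃. Word) : ran φ.symm = dom φ := by
  ext v; simp [dom, ran, ← PEquiv.mem_iff_mem φ]

theorem IsRightIdealIso.symm {φ : Word ≃. Word} (h : IsRightIdealIso φ) :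
    IsRightIdealIso φ.symm where
  dom_ideal := by rw [dom_symm]; exact h.ran_ideal
  ran_ideal := by rw [ran_symm]; exact h.dom_ideal
  map_append u v hv x := by
    rw [PEquiv.mem_iff_mem] at hv ⊢
    exact h.map_append _ _ hv x

theorem IsEssentialIso.symm {φ : Word ≃. Word} (h : IsEssentialIso φ) :
    IsEssentialIso φ.symm where
  toIsRightIdealIso := h.toIsRightIdealIso.symm
  dom_essential := by rw [dom_symm]; exact h.ran_essential
  ran_essential := by rw [ran_symm]; exact h.dom_essential

theorem symm_le_symm {φ ψ : Word ≃. Word} (h : φ ≤ ψ) : φ.symm ≤ ψ.symm := by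
  intro a b hb
  exact (PEquiv.mem_iff_mem ψ).2 (h _ _ ((PEquiv.mem_iff_mem φ).1 hb))

theorem IsMaximalIso.symm {φ : Word ≃. Word} (h : IsMaximalIso φ) : IsMaximalIso φ.symm where
  toIsEssentialIso := h.toIsEssentialIso.symm
  maximal Φ hΦ hle := by
    have := h.maximal Φ.symm hΦ.symm (by simpa using symm_le_symm hle)
    rw [← this, PEquiv.symm_symm]

theorem trans_le_trans {φ φ' ψ ψ' : Word ≃. Word} (h : φ ≤ φ') (h' : ψ ≤ ψ') :
    φ.trans ψ ≤ φ'.trans ψ' := by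
  intro a c hc
  rw [PEquiv.mem_trans] at hc ⊢
  obtain ⟨b, hb, hc⟩ := hc
  exact ⟨b, h _ _ hb, h' _ _ hc⟩

/-- It is enough to check that `φ` is equivariant. -/
theorem isRightIdealIso_of_map_append {φ : Word ≃. Word}
    (h : ∀ u v : Word, v ∈ φ u → ∀ x : Word, v ++ x ∈ φ (u ++ x)) : IsRightIdealIso φ where
  dom_ideal := fun u ⟨v, hv⟩ x => ⟨v ++ x, h u v hv x⟩
  ran_ideal := fun v ⟨u, hv⟩ x => ⟨u ++ x, h u v hv x⟩
  map_append := h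

/-- The composition of two isomorphisms between essential right ideals is again one. -/
theorem IsEssentialIso.trans {φ ψ : Word ≃. Word} (hφ : IsEssentialIso φ)
    (hψ : IsEssentialIso ψ) : IsEssentialIso (φ.trans ψ) := by
  have key : ∀ {φ ψ : Word ≃. Word}, IsEssentialIso φ → IsEssentialIso ψ →
      ∀ u : Word, ∃ x : Word, u ++ x ∈ dom (φ.trans ψ) := by
    intro φ ψ hφ hψ u
    obtain ⟨x, v, hv⟩ := hφ.dom_essential.exists_append u
    obtain ⟨y, w, hw⟩ := hψ.dom_essential.exists_append v
    refine ⟨x ++ y, w, (PEquiv.mem_trans _ _ _ _).2 ⟨v ++ y, ?_, hw⟩⟩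
    rw [← List.append_assoc]
    exact hφ.map_append _ _ hv y
  have hiso : IsRightIdealIso (φ.trans ψ) := by
    refine isRightIdealIso_of_map_append fun u w hw x => ?_
    rw [PEquiv.mem_trans] at hw ⊢
    obtain ⟨v, hv, hw⟩ := hw
    exact ⟨v ++ x, hφ.map_append _ _ hv x, hψ.map_append _ _ hw x⟩
  refine ⟨hiso, isEssential_of_exists hiso.dom_ideal (key hφ hψ),
    isEssential_of_exists hiso.ran_ideal ?_⟩
  rw [← dom_symm, PEquiv.symm_trans_rev]
  exact key hψ.symm hφ.symm

theorem eq_of_append_eq {u v x : Word} (h : u ++ x = v ++ x) : u = v :=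
  List.append_cancel_right h

/-- Every isomorphism between essential right ideals has a unique maximal extension. -/
theorem existsUnique_maximal {φ : Word ≃. Word} (hφ : IsEssentialIso φ) :
    ∃! Φ : Word ≃. Word, IsMaximalIso Φ ∧ φ ≤ Φ := by
  classical
  let E : Word → Word → Prop := fun u v => ∃ Φ : Word ≃. Word, IsRightIdealIso Φ ∧ φ ≤ Φ ∧ v ∈ Φ u
  have hfun : ∀ u v v', E u v → E u v' → v = v' := by
    rintro u v v' ⟨Φ, hΦ, hle, hv⟩ ⟨Φ', hΦ', hle', hv'⟩
    obtain ⟨x, w, hw⟩ := hφ.dom_essential.exists_append u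
    have h1 := Option.mem_unique (hle _ _ hw) (hΦ.map_append _ _ hv x)
    have h2 := Option.mem_unique (hle' _ _ hw) (hΦ'.map_append _ _ hv' x)
    exact eq_of_append_eq (h1.symm.trans h2)
  have hinj : ∀ u u' v, E u v → E u' v → u = u' := by
    rintro u u' v ⟨Φ, hΦ, hle, hv⟩ ⟨Φ', hΦ', hle', hv'⟩
    obtain ⟨x, w, hw⟩ := hφ.ran_essential.exists_append v
    have h1 := Φ.inj (hle _ _ hw) (hΦ.map_append _ _ hv x)
    have h2 := Φ'.inj (hle' _ _ hw) (hΦ'.map_append _ _ hv' x)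
    exact eq_of_append_eq (h1.symm.trans h2)
  let M : Word ≃. Word :=
    { toFun := fun u => if h : ∃ v, E u v then some h.choose else none
      invFun := fun v => if h : ∃ u, E u v then some h.choose else none
      inv := by
        intro u v
        have h1 : (if h : ∃ v, E u v then some h.choose else none) = some v ↔ E u v := by
          by_cases h : ∃ v, E u v
          · rw [dif_pos h, Option.some_inj]
            exact ⟨fun e => e ▸ h.choose_spec, fun e => hfun _ _ _ h.choose_spec e⟩
          · rw [dif_neg h]
            exact ⟨fun e => (Option.some_ne_none _ e.symm).elim, fun e => (h ⟨v, e⟩).elim⟩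
        have h2 : (if h : ∃ u, E u v then some h.choose else none) = some u ↔ E u v := by
          by_cases h : ∃ u, E u v
          · rw [dif_pos h, Option.some_inj]
            exact ⟨fun e => e ▸ h.choose_spec, fun e => hinj _ _ _ h.choose_spec e⟩
          · rw [dif_neg h]
            exact ⟨fun e => (Option.some_ne_none _ e.symm).elim, fun e => (h ⟨u, e⟩).elim⟩
        exact h2.trans h1.symm }
  have hM : ∀ u v, v ∈ M u ↔ E u v := by
    intro u v
    change (if h : ∃ v, E u v then some h.choose else none) = some v ↔ E u v
    by_cases h : ∃ v, E u v
    · rw [dif_pos h, Option.some_inj]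
      exact ⟨fun e => e ▸ h.choose_spec, fun e => hfun _ _ _ h.choose_spec e⟩
    · rw [dif_neg h]
      exact ⟨fun e => (Option.some_ne_none _ e.symm).elim, fun e => (h ⟨v, e⟩).elim⟩
  have hle : φ ≤ M := fun u v hv => (hM u v).2 ⟨φ, hφ.toIsRightIdealIso, le_rfl, hv⟩
  have hiso : IsRightIdealIso M := by
    refine isRightIdealIso_of_map_append fun u v hv x => ?_
    obtain ⟨Φ, hΦ, hle, hv⟩ := (hM u v).1 hv
    exact (hM _ _).2 ⟨Φ, hΦ, hle, hΦ.map_append _ _ hv x⟩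
  have hmax : ∀ Φ : Word ≃. Word, IsRightIdealIso Φ → φ ≤ Φ → Φ ≤ M :=
    fun Φ hΦ hle u v hv => (hM u v).2 ⟨Φ, hΦ, hle, hv⟩
  refine ⟨M, ⟨⟨⟨hiso, ?_, ?_⟩, ?_⟩, hle⟩, ?_⟩
  · refine isEssential_of_exists hiso.dom_ideal fun u => ?_
    obtain ⟨x, w, hw⟩ := hφ.dom_essential.exists_append u
    exact ⟨x, w, hle _ _ hw⟩
  · refine isEssential_of_exists hiso.ran_ideal fun u => ?_
    obtain ⟨x, w, hw⟩ := hφ.ran_essential.exists_append u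
    exact ⟨x, w, hle _ _ hw⟩
  · exact fun Φ hΦ h => le_antisymm (hmax Φ hΦ (hle.trans h)) h
  · rintro Φ ⟨hΦ, h⟩
    exact (hΦ.maximal M hiso (hmax Φ hΦ.toIsRightIdealIso h)).symm

/-- `max φ`: the maximum extension of an isomorphism `φ` between essential right ideals. -/
noncomputable def maxExt (φ : Word ≃. Word) (hφ : IsEssentialIso φ) : Word ≃. Word :=
  (existsUnique_maximal hφ).choose

theorem maxExt_maximal {φ : Word ≃. Word} (hφ : IsEssentialIso φ) : IsMaximalIso (maxExt φ hφ) :=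
  (existsUnique_maximal hφ).choose_spec.1.1

theorem le_maxExt {φ : Word ≃. Word} (hφ : IsEssentialIso φ) : φ ≤ maxExt φ hφ :=
  (existsUnique_maximal hφ).choose_spec.1.2

theorem eq_of_le_of_le {φ Φ Ψ : Word ≃. Word} (hφ : IsEssentialIso φ) (hΦ : IsMaximalIso Φ)
    (hΨ : IsMaximalIso Ψ) (h : φ ≤ Φ) (h' : φ ≤ Ψ) : Φ = Ψ :=
  (existsUnique_maximal hφ).unique ⟨hΦ, h⟩ ⟨hΨ, h'⟩

theorem refl_maximal : IsMaximalIso (PEquiv.refl Word) := by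
  have hdom : dom (PEquiv.refl Word) = Set.univ := by ext u; simp [dom]
  have hran : ran (PEquiv.refl Word) = Set.univ := by ext u; simp [ran]
  have huniv : IsEssential Set.univ :=
    ⟨fun _ _ _ => trivial, fun J _ hJ => by simpa using hJ⟩
  refine ⟨⟨isRightIdealIso_of_map_append ?_, hdom ▸ huniv, hran ▸ huniv⟩, ?_⟩
  · intro u v hv x
    simp only [PEquiv.refl_apply, Option.mem_def, Option.some_inj] at hv ⊢
    rw [hv]
  · intro Φ _ h
    ext1 u
    exact h u u rfl

/-! ### The Thompson groups -/

/-- The set underlying the Thompson group `𝒢_{2,1}`: all maximal isomorphisms between essential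
right ideals of `{a, b}*`. -/
def G21 : Type := {φ : Word ≃. Word // IsMaximalIso φ}

namespace G21

theorem comp_essential (φ ψ : G21) : IsEssentialIso (ψ.1.trans φ.1) :=
  ψ.2.toIsEssentialIso.trans φ.2.toIsEssentialIso

/-- `φ · ψ = max (φ ∘ ψ)`, where `ψ` is applied first. -/
noncomputable instance : Mul G21 :=
  ⟨fun φ ψ => ⟨maxExt (ψ.1.trans φ.1) (comp_essential φ ψ), maxExt_maximal _⟩⟩

/-- The identity map of `{a, b}*`. -/
instance : One G21 := ⟨⟨PEquiv.refl Word, refl_maximal⟩⟩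

/-- The inverse partial bijection. -/
instance : Inv G21 := ⟨fun φ => ⟨φ.1.symm, φ.2.symm⟩⟩

theorem comp_le_mul (φ ψ : G21) : ψ.1.trans φ.1 ≤ (φ * ψ).1 := le_maxExt (comp_essential φ ψ)

theorem eq_of_le {χ : Word ≃. Word} (hχ : IsEssentialIso χ) {φ ψ : G21} (h : χ ≤ φ.1)
    (h' : χ ≤ ψ.1) : φ = ψ :=
  Subtype.ext (eq_of_le_of_le hχ φ.2 ψ.2 h h')

noncomputable instance : Group G21 :=
  Group.ofLeftAxioms
    (by
      intro φ ψ χ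
      refine eq_of_le (χ := (χ.1.trans ψ.1).trans φ.1)
        ((comp_essential ψ χ).trans φ.2.toIsEssentialIso) ?_ ?_
      · rw [PEquiv.trans_assoc]
        exact (trans_le_trans le_rfl (comp_le_mul φ ψ)).trans (comp_le_mul (φ * ψ) χ)
      · exact (trans_le_trans (comp_le_mul ψ χ) le_rfl).trans (comp_le_mul φ (ψ * χ)))
    (by
      intro φ
      refine eq_of_le φ.2.toIsEssentialIso ?_ le_rfl
      have := comp_le_mul 1 φ
      rwa [show (1 : G21).1 = PEquiv.refl Word from rfl, PEquiv.trans_refl] at this)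
    (by
      intro φ
      refine eq_of_le (comp_essential φ⁻¹ φ) (comp_le_mul _ _) ?_
      intro u v hv
      rw [PEquiv.mem_trans] at hv
      obtain ⟨w, hw, hv⟩ := hv
      have : v = u := φ.1.inj ((PEquiv.mem_iff_mem φ.1).1 hv) hw
      rw [this]
      rfl)

end G21

/-- An essential right ideal is finitely generated iff it contains all sufficiently long words. -/
theorem isFinGen_iff {R : Set Word} (hR : IsEssential R) :
    IsFinGen R ↔ ∃ n : ℕ, ∀ u : Word, n ≤ u.length → u ∈ R := by
  constructor
  · rintro ⟨P, -, hfin, rfl⟩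
    obtain ⟨n, hn⟩ := (hfin.image List.length).bddAbove
    refine ⟨n, fun u hu => ?_⟩
    obtain ⟨x, p, hp, y, hxy⟩ := hR.exists_append u
    have hlen : p.length ≤ u.length := (hn ⟨p, hp, rfl⟩).trans hu
    obtain ⟨z, rfl⟩ := List.prefix_of_prefix_length_le ⟨y, hxy.symm⟩ ⟨x, rfl⟩ hlen
    exact ⟨p, hp, z, rfl⟩
  · rintro ⟨n, hn⟩
    refine ⟨{p | p ∈ R ∧ ∀ q ∈ R, q <+: p → q = p}, ?_, ?_, ?_⟩
    · rintro u ⟨hu, -⟩ v ⟨-, hv⟩ huv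
      exact hv u hu huv
    · refine (List.finite_length_le Letter n).subset ?_
      rintro p ⟨-, hp⟩
      by_contra hlen
      simp only [Set.mem_ofPred_eq, not_le] at hlen
      have h := hp (p.take n) (hn _ (by simp; omega)) (List.take_prefix n p)
      have := congrArg List.length h
      simp at this
      omega
    · ext w
      constructor
      · intro hw
        induction hl : w.length using Nat.strong_induction_on generalizing w with
        | _ l ih =>
          by_cases hmin : ∀ q ∈ R, q <+: w → q = w
          · exact ⟨w, ⟨hw, hmin⟩, [], by simp⟩
          · push Not at hmin
            obtain ⟨q, hq, ⟨z, rfl⟩, hne⟩ := hmin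
            have hz : z ≠ [] := by rintro rfl; simp at hne
            have hzl := List.length_pos_iff.2 hz
            obtain ⟨p, hp, x, hx⟩ := ih q.length (by simp at hl; omega) q hq rfl
            exact ⟨p, hp, x ++ z, by rw [hx, List.append_assoc]⟩
      · rintro ⟨p, ⟨hp, -⟩, x, rfl⟩
        exact hR.1 p hp x

theorem isFinGen_mono {R S : Set Word} (hR : IsEssential R) (hS : IsEssential S) (h : R ⊆ S)
    (hfin : IsFinGen R) : IsFinGen S := by
  rw [isFinGen_iff hR] at hfin
  rw [isFinGen_iff hS]
  obtain ⟨n, hn⟩ := hfin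
  exact ⟨n, fun u hu => h (hn u hu)⟩

theorem isFinGen_dom_trans {φ ψ : Word ≃. Word} (hφ : IsEssentialIso φ) (hψ : IsEssentialIso ψ)
    (h : IsFinGen (dom φ)) (h' : IsFinGen (dom ψ)) : IsFinGen (dom (φ.trans ψ)) := by
  rw [isFinGen_iff hφ.dom_essential] at h
  rw [isFinGen_iff hψ.dom_essential] at h'
  rw [isFinGen_iff (hφ.trans hψ).dom_essential]
  obtain ⟨n, hn⟩ := h
  obtain ⟨m, hm⟩ := h'
  refine ⟨n + m, fun u hu => ?_⟩
  obtain ⟨v, hv⟩ := hn (u.take n) (by simp; omega)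
  have hv' := hφ.map_append _ _ hv (u.drop n)
  rw [List.take_append_drop] at hv'
  obtain ⟨w, hw⟩ := hm (v ++ u.drop n) (by simp; omega)
  exact ⟨w, (PEquiv.mem_trans _ _ _ _).2 ⟨_, hv', hw⟩⟩

/-- The Thompson group `V`: the subgroup of `𝒢_{2,1}` of all maximal isomorphisms between finitely
generated essential right ideals of `{a, b}*`. -/
noncomputable def V : Subgroup G21 where
  carrier := {φ | IsFinGen (dom φ.1) ∧ IsFinGen (ran φ.1)}
  mul_mem' := by
    rintro φ ψ ⟨h1, h2⟩ ⟨h3, h4⟩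
    have hφ := φ.2.toIsEssentialIso
    have hψ := ψ.2.toIsEssentialIso
    have hle := G21.comp_le_mul φ ψ
    have hc := G21.comp_essential φ ψ
    refine ⟨isFinGen_mono hc.dom_essential (φ * ψ).2.dom_essential ?_
        (isFinGen_dom_trans hψ hφ h3 h1),
      isFinGen_mono hc.ran_essential (φ * ψ).2.ran_essential ?_ ?_⟩
    · rintro u ⟨v, hv⟩
      exact ⟨v, hle _ _ hv⟩
    · rintro v ⟨u, hv⟩
      exact ⟨u, hle _ _ hv⟩
    · rw [← dom_symm, PEquiv.symm_trans_rev]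
      exact isFinGen_dom_trans hφ.symm hψ.symm (by rwa [dom_symm]) (by rwa [dom_symm])
  one_mem' := by
    have h : IsFinGen Set.univ :=
      ⟨{[]}, by rintro u rfl v rfl -; rfl, Set.finite_singleton _, by
        ext w; simp [generatedBy]⟩
    have hdom : dom (PEquiv.refl Word) = Set.univ := by ext u; simp [dom]
    have hran : ran (PEquiv.refl Word) = Set.univ := by ext u; simp [ran]
    exact ⟨hdom ▸ h, hran ▸ h⟩
  inv_mem' := by
    rintro φ ⟨h1, h2⟩
    exact ⟨(dom_symm φ.1).symm ▸ h2, (ran_symm φ.1).symm ▸ h1⟩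

/-! ### The polycyclic monoid -/

/-- The polycyclic monoid `PC(a, b)` in normal form: its elements are `0` and the `y x⁻¹` with
`y, x ∈ A*`, where `pair y x` stands for `y x⁻¹`. -/
inductive PC
  | zero : PC
  | pair (y x : Word) : PC

namespace PC

instance : Zero PC := ⟨PC.zero⟩

/-- The identity is `ε ε⁻¹`. -/
instance : One PC := ⟨PC.pair [] []⟩

/-- `v u⁻¹ · t s⁻¹` is `v z s⁻¹` if `t = u z`, it is `v (s z)⁻¹` if `u = t z`, and it is `0` if
`u` and `t` are not prefix-comparable. -/
instance : Mul PC :=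
  ⟨fun p q => match p, q with
    | pair v u, pair t s =>
      if u <+: t then pair (v ++ t.drop u.length) s
      else if t <+: u then pair v (s ++ u.drop t.length)
      else zero
    | _, _ => zero⟩

theorem zero_mul' (p : PC) : 0 * p = 0 := rfl

theorem mul_zero' (p : PC) : p * 0 = 0 := by cases p <;> rfl

theorem pair_mul_pair (v u t s : Word) : pair v u * pair t s =
    if u <+: t then pair (v ++ t.drop u.length) s
    else if t <+: u then pair v (s ++ u.drop t.length) else 0 := rfl

theorem pair_ne_zero (y x : Word) : pair y x ≠ 0 := PC.noConfusion

/-- `y x⁻¹` as a relation on `A*`: it relates `x z` to `y z`. -/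
def Graph : PC → Word → Word → Prop
  | zero, _, _ => False
  | pair y x, w, c => ∃ z, w = x ++ z ∧ c = y ++ z

theorem graph_mul (p q : PC) (w c : Word) :
    Graph (p * q) w c ↔ ∃ m, Graph q w m ∧ Graph p m c := by
  rcases p with _ | ⟨v, u⟩
  · exact ⟨fun h => h.elim, fun ⟨m, _, h⟩ => h⟩
  rcases q with _ | ⟨t, s⟩
  · exact ⟨fun h => h.elim, fun ⟨m, h, _⟩ => h⟩
  rw [pair_mul_pair]
  by_cases h1 : u <+: t
  · rw [if_pos h1]
    obtain ⟨r, rfl⟩ := h1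
    simp only [Graph, List.drop_left]
    constructor
    · rintro ⟨z, rfl, rfl⟩
      exact ⟨u ++ r ++ z, ⟨z, rfl, rfl⟩, r ++ z, by simp, by simp⟩
    · rintro ⟨m, ⟨z, rfl, rfl⟩, z', h, rfl⟩
      rw [List.append_assoc, List.append_cancel_left_eq] at h
      exact ⟨z, rfl, by simp [← h]⟩
  · rw [if_neg h1]
    by_cases h2 : t <+: u
    · rw [if_pos h2]
      obtain ⟨r, rfl⟩ := h2
      simp only [Graph, List.drop_left]
      constructor
      · rintro ⟨z, rfl, rfl⟩
        exact ⟨t ++ r ++ z, ⟨r ++ z, by simp, by simp⟩, z, by simp, by simp⟩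
      · rintro ⟨m, ⟨z, rfl, rfl⟩, z', h, rfl⟩
        rw [List.append_assoc, List.append_cancel_left_eq] at h
        exact ⟨z', by simp [h], rfl⟩
    · rw [if_neg h2]
      refine ⟨fun h => h.elim, ?_⟩
      rintro ⟨m, ⟨z, rfl, rfl⟩, z', h, rfl⟩
      rcases List.prefix_or_prefix_of_prefix (l₁ := u) (l₂ := t) (l₃ := t ++ z) ⟨z', h.symm⟩
        ⟨z, rfl⟩ with h | h
      · exact h1 h
      · exact h2 h

theorem graph_injective {p q : PC} (h : ∀ w c, Graph p w c ↔ Graph q w c) : p = q := by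
  rcases p with _ | ⟨y, x⟩ <;> rcases q with _ | ⟨y', x'⟩
  · rfl
  · exact ((h x' y').2 ⟨[], by simp, by simp⟩).elim
  · exact ((h x y).1 ⟨[], by simp, by simp⟩).elim
  · obtain ⟨z, hx, hy⟩ := (h x y).1 ⟨[], by simp, by simp⟩
    obtain ⟨z', hx', hy'⟩ := (h x' y').2 ⟨[], by simp, by simp⟩
    have hz : z = [] := by
      have := congrArg List.length hx
      have h2 := congrArg List.length hx'
      simp at this h2
      exact List.length_eq_zero_iff.1 (by omega)
    subst hz
    simp at hx hy
    rw [hx, hy]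

instance : MonoidWithZero PC where
  mul_assoc p q r := by
    refine graph_injective fun w c => ?_
    simp only [graph_mul]
    constructor
    · rintro ⟨m, h1, n, h2, h3⟩
      exact ⟨n, ⟨m, h1, h2⟩, h3⟩
    · rintro ⟨n, ⟨m, h1, h2⟩, h3⟩
      exact ⟨m, h1, n, h2, h3⟩
  one_mul p := by
    refine graph_injective fun w c => ?_
    rw [graph_mul]
    constructor
    · rintro ⟨m, h, z, rfl, rfl⟩
      exact h
    · exact fun h => ⟨c, h, c, rfl, rfl⟩
  mul_one p := by
    refine graph_injective fun w c => ?_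
    rw [graph_mul]
    constructor
    · rintro ⟨m, ⟨z, rfl, rfl⟩, h⟩
      exact h
    · exact fun h => ⟨w, ⟨w, rfl, rfl⟩, h⟩
  zero_mul := zero_mul'
  mul_zero := mul_zero'

/-- The word `y`, as an element of `PC(a, b)`. -/
def word (y : Word) : PC := pair y []

/-- The inverse `x⁻¹` of the word `x`, as an element of `PC(a, b)`. -/
def wordInv (x : Word) : PC := pair [] x

theorem word_mul_wordInv (y x : Word) : word y * wordInv x = pair y x := by
  simp [word, wordInv, pair_mul_pair]

theorem word_append (y z : Word) : word (y ++ z) = word y * word z := by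
  simp [word, pair_mul_pair]

theorem wordInv_append (y z : Word) : wordInv (y ++ z) = wordInv z * wordInv y := by
  simp only [wordInv, pair_mul_pair, List.nil_append, List.length_nil, List.drop_zero,
    List.nil_prefix, if_true]
  split_ifs with h
  · rw [List.prefix_nil.1 h]; simp
  · rfl

/-- The defining relations: `α⁻¹ α = 1`, and `α⁻¹ β = 0` for letters `α ≠ β`. -/
theorem relations (α β : Letter) : wordInv [α] * word [β] = if α = β then 1 else 0 := by
  simp only [wordInv, word, pair_mul_pair]
  by_cases h : α = β
  · subst h; simp; rfl
  · have h' : β ≠ α := fun e => h e.symm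
    simp [h, h']

/-- `PC(a, b)` is an inverse monoid, and the inverse of `y x⁻¹` is `x y⁻¹`. -/
theorem existsUnique_inverse (p : PC) : ∃! q : PC, p * q * p = p ∧ q * p * q = q := by
  have hinj : ∀ {p : PC} {w w' c : Word}, Graph p w c → Graph p w' c → w = w' := by
    rintro (_ | ⟨y, x⟩) w w' c h h'
    · exact h.elim
    · obtain ⟨z, rfl, rfl⟩ := h
      obtain ⟨z', rfl, h⟩ := h'
      rw [List.append_cancel_left h]
  have hfun : ∀ {p : PC} {w c c' : Word}, Graph p w c → Graph p w c' → c = c' := by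
    rintro (_ | ⟨y, x⟩) w c c' h h'
    · exact h.elim
    · obtain ⟨z, rfl, rfl⟩ := h
      obtain ⟨z', h, rfl⟩ := h'
      rw [List.append_cancel_left h]
  have hconv : ∀ {p q : PC}, p * q * p = p → ∀ {w c : Word}, Graph p w c → Graph q c w := by
    intro p q h w c hg
    have hg' := hg
    rw [← h, graph_mul] at hg'
    obtain ⟨m, h1, h2⟩ := hg'
    rw [graph_mul] at h2
    obtain ⟨n, h3, h4⟩ := h2
    rwa [hfun h1 hg, hinj h4 hg] at h3
  have hq : ∃ q : PC, p * q * p = p ∧ q * p * q = q := by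
    rcases p with _ | ⟨y, x⟩
    · exact ⟨0, rfl, rfl⟩
    · exact ⟨pair x y, by simp [pair_mul_pair], by simp [pair_mul_pair]⟩
  obtain ⟨q, h1, h2⟩ := hq
  refine ⟨q, ⟨h1, h2⟩, ?_⟩
  rintro q' ⟨h3, h4⟩
  exact graph_injective fun w c => ⟨fun h => hconv h1 (hconv h4 h), fun h => hconv h3 (hconv h2 h)⟩

/-- `PC(a, b)` is presented by its defining relations: two maps `f, g` from the letters to a monoid
with zero that satisfy `g α * f α = 1`, and `g α * f β = 0` for `α ≠ β`, extend in exactly one way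
to a homomorphism. -/
theorem existsUnique_lift {M : Type*} [MonoidWithZero M] (f g : Letter → M)
    (h : ∀ α β, g α * f β = if α = β then 1 else 0) :
    ∃! F : PC →*₀ M, (∀ α, F (word [α]) = f α) ∧ ∀ α, F (wordInv [α]) = g α := by
  have hcancel : ∀ u : Word, (u.reverse.map g).prod * (u.map f).prod = 1 := by
    intro u
    induction u with
    | nil => simp
    | cons α u ih =>
      simp only [List.reverse_cons, List.map_append, List.prod_append, List.map_cons,
        List.map_nil, List.prod_cons, List.prod_nil, mul_one]
      rw [mul_assoc, ← mul_assoc (g α), h, if_pos rfl, one_mul, ih]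
  have hzero : ∀ u t : Word, ¬ u <+: t → ¬ t <+: u →
      (u.reverse.map g).prod * (t.map f).prod = 0 := by
    intro u
    induction u with
    | nil => intro t h1; exact (h1 t.nil_prefix).elim
    | cons α u ih =>
      intro t h1 h2
      cases t with
      | nil => exact (h2 (List.nil_prefix)).elim
      | cons β t =>
        simp only [List.reverse_cons, List.map_append, List.prod_append, List.map_cons,
          List.map_nil, List.prod_cons, List.prod_nil, mul_one]
        rw [mul_assoc, ← mul_assoc (g α), h]
        by_cases hαβ : α = β
        · subst hαβ
          rw [if_pos rfl, one_mul]
          exact ih t (fun e => h1 (by simpa using e)) (fun e => h2 (by simpa using e))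
        · rw [if_neg hαβ, zero_mul, mul_zero]
  let F : PC →*₀ M :=
    { toFun := fun p => match p with
        | zero => 0
        | pair y x => (y.map f).prod * (x.reverse.map g).prod
      map_zero' := rfl
      map_one' := by change (List.map f []).prod * _ = 1; simp
      map_mul' := by
        rintro (_ | ⟨v, u⟩) (_ | ⟨t, s⟩)
        · exact (zero_mul _).symm
        · exact (zero_mul _).symm
        · exact (mul_zero _).symm
        · rw [pair_mul_pair]
          change _ = (v.map f).prod * (u.reverse.map g).prod *
            ((t.map f).prod * (s.reverse.map g).prod)
          rw [mul_assoc, ← mul_assoc (u.reverse.map g).prod]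
          split_ifs with h1 h2
          · obtain ⟨r, rfl⟩ := h1
            rw [List.map_append, List.prod_append, ← mul_assoc _ (u.map f).prod, hcancel]
            simp [mul_assoc]
          · obtain ⟨r, rfl⟩ := h2
            rw [List.reverse_append, List.map_append, List.prod_append, mul_assoc _ _ (t.map f).prod,
              hcancel]
            simp
          · rw [hzero u t h1 h2, zero_mul, mul_zero] }
  have hFw : ∀ α, F (word [α]) = f α := fun α => by
    change (List.map f [α]).prod * (List.map g ([] : Word).reverse).prod = f α
    simp
  have hFi : ∀ α, F (wordInv [α]) = g α := fun α => by
    change (List.map f []).prod * (List.map g [α].reverse).prod = g α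
    simp
  refine ⟨F, ⟨hFw, hFi⟩, ?_⟩
  rintro G ⟨hGw, hGi⟩
  have hw : ∀ y : Word, G (word y) = F (word y) := by
    intro y
    induction y with
    | nil => exact (map_one G).trans (map_one F).symm
    | cons α y ih =>
      rw [show α :: y = [α] ++ y from rfl, word_append, map_mul, map_mul, ih, hGw, hFw]
  have hi : ∀ x : Word, G (wordInv x) = F (wordInv x) := by
    intro x
    induction x with
    | nil => exact (map_one G).trans (map_one F).symm
    | cons α x ih =>
      rw [show α :: x = [α] ++ x from rfl, wordInv_append, map_mul, map_mul, ih, hGi, hFi]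
  ext p
  rcases p with _ | ⟨y, x⟩
  · exact (map_zero G).trans (map_zero F).symm
  · rw [← word_mul_wordInv, map_mul, map_mul, hw, hi]

end PC

/-! ### The algebra `𝒞_V = K[PC(a, b)] / I_V` -/

section AlgebraV

variable (K : Type*) [Field K]

/-- `K[PC(a, b)]`: the algebra of the finite sums `∑ κᵢ yᵢ xᵢ⁻¹`, that is, the monoid algebra of
`PC(a, b)` in which the zero of the monoid is identified with the zero of the algebra. -/
abbrev KPC : Type _ :=
  (TwoSidedIdeal.span {MonoidAlgebra.single (0 : PC) (1 : K)}).ringCon.Quotient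

/-- The element `y x⁻¹` of `K[PC(a, b)]`. -/
noncomputable def kpair (y x : Word) : KPC K :=
  RingCon.mk' _ (MonoidAlgebra.single (PC.pair y x) (1 : K))

/-- The ideal `I_V` generated by `a a⁻¹ + b b⁻¹ - 1`. -/
noncomputable def IV : TwoSidedIdeal (KPC K) :=
  TwoSidedIdeal.span {kpair K [Letter.a] [Letter.a] + kpair K [Letter.b] [Letter.b] - 1}

/-- `𝒞_V = K[PC(a, b)] / I_V`. -/
abbrev CV : Type _ := (IV K).ringCon.Quotient

/-- The set `𝒰_V` of unary sums `∑_{i ∈ I} yᵢ xᵢ⁻¹` with finite index set `I`: both `i ↦ xᵢ` and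
`i ↦ yᵢ` are bijections from `I` onto a maximal prefix code. -/
def UV : Set (KPC K) :=
  {s | ∃ (I : Finset ℕ) (x y : I → Word), Function.Injective x ∧ Function.Injective y ∧
    IsMaximalPrefixCode (Set.range x) ∧ IsMaximalPrefixCode (Set.range y) ∧
    s = ∑ i, kpair K (y i) (x i)}

/-- `𝒰_V / I_V`: the set of the classes of the elements of `𝒰_V` in `𝒞_V`. -/
def UVmodIV : Set (CV K) := (IV K).ringCon.mk' '' UV K

end AlgebraV

/-! ### The algebra `ℬ_∞` of finite-to-finite infinite sums -/

/-- A relation between words is finite-to-finite: each word is related to finitely many words, on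
either side. -/
def FiniteToFinite (S : Set (Word × Word)) : Prop :=
  (∀ y : Word, {x : Word | (y, x) ∈ S}.Finite) ∧ ∀ x : Word, {y : Word | (y, x) ∈ S}.Finite

theorem FiniteToFinite.mono {S T : Set (Word × Word)} (hT : FiniteToFinite T) (h : S ⊆ T) :
    FiniteToFinite S :=
  ⟨fun y => (hT.1 y).subset fun _ hx => h hx, fun x => (hT.2 x).subset fun _ hy => h hy⟩

theorem FiniteToFinite.union {S T : Set (Word × Word)} (hS : FiniteToFinite S)
    (hT : FiniteToFinite T) : FiniteToFinite (S ∪ T) :=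
  ⟨fun y => ((hS.1 y).union (hT.1 y)).subset fun _ hx => hx,
    fun x => ((hS.2 x).union (hT.2 x)).subset fun _ hy => hy⟩

theorem FiniteToFinite.swap {S : Set (Word × Word)} (hS : FiniteToFinite S) :
    FiniteToFinite (Prod.swap ⁻¹' S) := ⟨hS.2, hS.1⟩

/-- The element `y x⁻¹` of `PC(a, b)` that belongs to the pair `(y, x)`. -/
def toPC (p : Word × Word) : PC := PC.pair p.1 p.2

theorem toPC_injective : Function.Injective toPC := by
  rintro ⟨y, x⟩ ⟨y', x'⟩ h
  simpa [toPC] using h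

theorem toPC_swap_mul {p q m : Word × Word} (h : toPC p * toPC q = toPC m) :
    toPC q.swap * toPC p.swap = toPC m.swap := by
  have hg : ∀ (p : Word × Word) (w c : Word),
      PC.Graph (toPC p.swap) w c ↔ PC.Graph (toPC p) c w := by
    rintro ⟨y, x⟩ w c
    exact ⟨fun ⟨z, h1, h2⟩ => ⟨z, h2, h1⟩, fun ⟨z, h1, h2⟩ => ⟨z, h2, h1⟩⟩
  refine PC.graph_injective fun w c => ?_
  rw [hg, ← h, PC.graph_mul, PC.graph_mul]
  simp only [hg]
  exact ⟨fun ⟨m, h1, h2⟩ => ⟨m, h2, h1⟩, fun ⟨m, h1, h2⟩ => ⟨m, h2, h1⟩⟩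

theorem finite_factorizations_left {S T : Set (Word × Word)} (hS : FiniteToFinite S)
    (hT : FiniteToFinite T) (y : Word) :
    {z : (Word × Word) × (Word × Word) | z.1 ∈ S ∧ z.2 ∈ T ∧
      ∃ x, toPC z.1 * toPC z.2 = toPC (y, x)}.Finite := by
  have hpre : ∀ w : Word, {v : Word | v <+: w}.Finite := fun w =>
    (List.finite_toSet w.inits).subset fun v hv => (List.mem_inits v w).2 hv
  have hfin : (⋃ v ∈ {v : Word | v <+: y}, ⋃ u ∈ {u : Word | (v, u) ∈ S},
      ⋃ t ∈ insert (u ++ y.drop v.length) {t : Word | t <+: u}, ⋃ s ∈ {s : Word | (t, s) ∈ T},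
      ({((v, u), (t, s))} : Set ((Word × Word) × (Word × Word)))).Finite := by
    refine (hpre y).biUnion fun v _ => (hS.1 v).biUnion fun u _ => ?_
    refine ((hpre u).insert _).biUnion fun t _ => (hT.1 t).biUnion fun s _ => ?_
    exact Set.finite_singleton _
  refine hfin.subset ?_
  rintro ⟨⟨v, u⟩, ⟨t, s⟩⟩ ⟨h1, h2, x, h⟩
  simp only [Set.mem_iUnion]
  rw [toPC, toPC, toPC, PC.pair_mul_pair] at h
  dsimp only at h h1 h2
  split_ifs at h with h3 h4
  · obtain ⟨r, rfl⟩ := h3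
    injection h with hy hx
    rw [List.drop_left] at hy
    subst hy
    exact ⟨v, ⟨r, rfl⟩, u, h1, u ++ r, by simp, s, h2, rfl⟩
  · injection h with hy hx
    subst hy
    exact ⟨v, List.prefix_refl v, u, h1, t, Or.inr h4, s, h2, rfl⟩

theorem finite_factorizations_right {S T : Set (Word × Word)} (hS : FiniteToFinite S)
    (hT : FiniteToFinite T) (x : Word) :
    {z : (Word × Word) × (Word × Word) | z.1 ∈ S ∧ z.2 ∈ T ∧
      ∃ y, toPC z.1 * toPC z.2 = toPC (y, x)}.Finite := by
  refine ((finite_factorizations_left hT.swap hS.swap x).image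
    fun z => (z.2.swap, z.1.swap)).subset ?_
  rintro ⟨p, q⟩ ⟨h1, h2, y, h⟩
  exact ⟨(q.swap, p.swap), ⟨by simpa using h2, by simpa using h1, y, toPC_swap_mul h⟩, rfl⟩

theorem finite_factorizations {S T : Set (Word × Word)} (hS : FiniteToFinite S)
    (hT : FiniteToFinite T) (p : Word × Word) :
    {z : (Word × Word) × (Word × Word) | z.1 ∈ S ∧ z.2 ∈ T ∧
      toPC z.1 * toPC z.2 = toPC p}.Finite :=
  (finite_factorizations_left hS hT p.1).subset fun _ hz => ⟨hz.1, hz.2.1, p.2, hz.2.2⟩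

/-- The set of the products of the elements of `S` with those of `T`, without `0`. -/
def mulRel (S T : Set (Word × Word)) : Set (Word × Word) :=
  {p | ∃ q ∈ S, ∃ r ∈ T, toPC q * toPC r = toPC p}

theorem FiniteToFinite.mulRel {S T : Set (Word × Word)} (hS : FiniteToFinite S)
    (hT : FiniteToFinite T) : FiniteToFinite (mulRel S T) := by
  have hfin : ∀ z : (Word × Word) × (Word × Word), {p | toPC z.1 * toPC z.2 = toPC p}.Finite :=
    fun z => Set.Subsingleton.finite fun p hp q hq => toPC_injective (hp.symm.trans hq)
  constructor
  · intro y
    refine (((finite_factorizations_left hS hT y).biUnion fun z _ => hfin z).image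
      Prod.snd).subset ?_
    rintro x ⟨q, hq, r, hr, h⟩
    exact ⟨(y, x), Set.mem_biUnion (x := (q, r)) ⟨hq, hr, x, h⟩ h, rfl⟩
  · intro x
    refine (((finite_factorizations_right hS hT x).biUnion fun z _ => hfin z).image
      Prod.fst).subset ?_
    rintro y ⟨q, hq, r, hr, h⟩
    exact ⟨(y, x), Set.mem_biUnion (x := (q, r)) ⟨hq, hr, y, h⟩ h, rfl⟩

section AlgebraB

variable (K : Type*) [Field K]

/-- The coefficient functions of the elements of `ℬ_∞`. -/
def BInfSubmodule : Submodule K (Word × Word → K) where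
  carrier := {s | FiniteToFinite (Function.support s)}
  add_mem' := fun {s t} hs ht =>
    (FiniteToFinite.union hs ht).mono (Function.support_add s t)
  zero_mem' := by
    change FiniteToFinite (Function.support (0 : Word × Word → K))
    rw [Function.support_zero]
    exact ⟨fun _ => Set.finite_empty, fun _ => Set.finite_empty⟩
  smul_mem' := fun c s hs => FiniteToFinite.mono hs (Function.support_const_smul_subset c s)

/-- `ℬ_∞`: the possibly infinite formal sums `∑ κᵢ yᵢ xᵢ⁻¹` for which the relation of all the pairs
`(yᵢ, xᵢ)` is finite-to-finite. Such a sum is given by its coefficients: the value of the function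
at `(y, x)` is the coefficient of `y x⁻¹`. -/
def BInf : Type _ := BInfSubmodule K

noncomputable instance : AddCommGroup (BInf K) := inferInstanceAs (AddCommGroup (BInfSubmodule K))

noncomputable instance : Module K (BInf K) := inferInstanceAs (Module K (BInfSubmodule K))

namespace BInf

variable {K}

/-- The coefficient of `y x⁻¹`, where `p = (y, x)`. -/
def coeff (s : BInf K) (p : Word × Word) : K := s.1 p

theorem finiteToFinite (s : BInf K) : FiniteToFinite (Function.support s.coeff) := s.2

@[ext] theorem ext {s t : BInf K} (h : ∀ p, s.coeff p = t.coeff p) : s = t :=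
  Subtype.ext (funext h)

theorem coeff_add (s t : BInf K) (p : Word × Word) : (s + t).coeff p = s.coeff p + t.coeff p := rfl

theorem coeff_zero (p : Word × Word) : (0 : BInf K).coeff p = 0 := rfl

theorem coeff_neg (s : BInf K) (p : Word × Word) : (-s).coeff p = -s.coeff p := rfl

theorem coeff_sub (s t : BInf K) (p : Word × Word) : (s - t).coeff p = s.coeff p - t.coeff p := rfl

theorem coeff_smul (c : K) (s : BInf K) (p : Word × Word) : (c • s).coeff p = c * s.coeff p := rfl

open Classical in
/-- The coefficient of the product `s t` at `p`: the sum of all the `s_q t_r` with `q r = p` in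
`PC(a, b)`. Only finitely many of these are nonzero. -/
noncomputable def mulCoeff (s t : BInf K) (p : Word × Word) : K :=
  ∑ᶠ z : (Word × Word) × (Word × Word),
    if toPC z.1 * toPC z.2 = toPC p then s.coeff z.1 * t.coeff z.2 else 0

open Classical in
theorem mulCoeff_finite (s t : BInf K) (p : Word × Word) :
    (Function.support fun z : (Word × Word) × (Word × Word) =>
      if toPC z.1 * toPC z.2 = toPC p then s.coeff z.1 * t.coeff z.2 else 0).Finite := by
  refine (finite_factorizations s.finiteToFinite t.finiteToFinite p).subset fun z hz => ?_
  rw [Function.mem_support, ne_eq, ite_eq_right_iff, Classical.not_imp] at hz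
  exact ⟨left_ne_zero_of_mul hz.2, right_ne_zero_of_mul hz.2, hz.1⟩

theorem support_mulCoeff (s t : BInf K) :
    Function.support (mulCoeff s t) ⊆
      mulRel (Function.support s.coeff) (Function.support t.coeff) := by
  classical
  intro p hp
  obtain ⟨z, hz⟩ : ∃ z : (Word × Word) × (Word × Word),
      (if toPC z.1 * toPC z.2 = toPC p then s.coeff z.1 * t.coeff z.2 else 0) ≠ 0 := by
    by_contra hc
    push Not at hc
    exact hp (finsum_eq_zero_of_forall_eq_zero hc)
  rw [ne_eq, ite_eq_right_iff, Classical.not_imp] at hz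
  exact ⟨z.1, left_ne_zero_of_mul hz.2, z.2, right_ne_zero_of_mul hz.2, hz.1⟩

noncomputable instance : Mul (BInf K) :=
  ⟨fun s t => ⟨mulCoeff s t,
    (s.finiteToFinite.mulRel t.finiteToFinite).mono (support_mulCoeff s t)⟩⟩

theorem coeff_mul (s t : BInf K) (p : Word × Word) : (s * t).coeff p = mulCoeff s t p := rfl

open Classical in
/-- The sum `y x⁻¹` with a single term, with coefficient `1`. -/
noncomputable def mono (y x : Word) : BInf K :=
  ⟨fun p => if p = (y, x) then 1 else 0, by
    constructor
    · intro v
      refine (Set.finite_singleton x).subset fun u hu => ?_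
      have h : (v, u) = (y, x) := by by_contra h; exact hu (if_neg h)
      exact congrArg Prod.snd h
    · intro u
      refine (Set.finite_singleton y).subset fun v hv => ?_
      have h : (v, u) = (y, x) := by by_contra h; exact hv (if_neg h)
      exact congrArg Prod.fst h⟩

open Classical in
theorem coeff_mono (y x : Word) (p : Word × Word) :
    (mono y x : BInf K).coeff p = if p = (y, x) then 1 else 0 := rfl

noncomputable instance : One (BInf K) := ⟨mono [] []⟩

theorem toPC_nil : toPC ([], []) = 1 := rfl

theorem one_mul' (s : BInf K) : 1 * s = s := by
  classical
  ext p
  rw [coeff_mul, mulCoeff, finsum_eq_single _ (([], []), p)]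
  · rw [toPC_nil, one_mul, if_pos rfl]
    change (mono [] [] : BInf K).coeff _ * _ = _
    rw [coeff_mono, if_pos rfl, one_mul]
  · rintro ⟨q, r⟩ hne
    split_ifs with h
    · change (mono [] [] : BInf K).coeff q * _ = 0
      rw [coeff_mono, if_neg, zero_mul]
      rintro rfl
      rw [toPC_nil, one_mul] at h
      exact hne (Prod.ext rfl (toPC_injective h))
    · rfl

theorem mul_one' (s : BInf K) : s * 1 = s := by
  classical
  ext p
  rw [coeff_mul, mulCoeff, finsum_eq_single _ (p, ([], []))]
  · rw [toPC_nil, mul_one, if_pos rfl]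
    change _ * (mono [] [] : BInf K).coeff _ = _
    rw [coeff_mono, if_pos rfl, mul_one]
  · rintro ⟨q, r⟩ hne
    split_ifs with h
    · change _ * (mono [] [] : BInf K).coeff r = 0
      rw [coeff_mono, if_neg, mul_zero]
      rintro rfl
      rw [toPC_nil, mul_one] at h
      exact hne (Prod.ext (toPC_injective h) rfl)
    · rfl

theorem left_distrib' (s t u : BInf K) : s * (t + u) = s * t + s * u := by
  classical
  ext p
  rw [coeff_add, coeff_mul, coeff_mul, coeff_mul, mulCoeff, mulCoeff, mulCoeff,
    ← finsum_add_distrib (mulCoeff_finite s t p) (mulCoeff_finite s u p)]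
  refine finsum_congr fun z => ?_
  split_ifs
  · rw [coeff_add, mul_add]
  · rw [add_zero]

theorem right_distrib' (s t u : BInf K) : (s + t) * u = s * u + t * u := by
  classical
  ext p
  rw [coeff_add, coeff_mul, coeff_mul, coeff_mul, mulCoeff, mulCoeff, mulCoeff,
    ← finsum_add_distrib (mulCoeff_finite s u p) (mulCoeff_finite t u p)]
  refine finsum_congr fun z => ?_
  split_ifs
  · rw [coeff_add, add_mul]
  · rw [add_zero]

theorem smul_mul' (c : K) (s t : BInf K) : c • s * t = c • (s * t) := by
  classical
  ext p
  rw [coeff_smul, coeff_mul, coeff_mul, mulCoeff, mulCoeff, mul_finsum]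
  refine finsum_congr fun z => ?_
  rw [coeff_smul, mul_ite, mul_zero, mul_assoc]

theorem mul_smul' (c : K) (s t : BInf K) : s * c • t = c • (s * t) := by
  classical
  ext p
  rw [coeff_smul, coeff_mul, coeff_mul, mulCoeff, mulCoeff, mul_finsum]
  refine finsum_congr fun z => ?_
  rw [coeff_smul, mul_ite, mul_zero, mul_left_comm]

theorem mul_assoc' (s t u : BInf K) : s * t * u = s * (t * u) := by
  classical
  ext p
  let T : Set ((Word × Word) × (Word × Word) × (Word × Word)) :=
    {z | z.1 ∈ Function.support s.coeff ∧ z.2.1 ∈ Function.support t.coeff ∧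
      z.2.2 ∈ Function.support u.coeff ∧ toPC z.1 * toPC z.2.1 * toPC z.2.2 = toPC p}
  let g : (Word × Word) × (Word × Word) × (Word × Word) → K := fun z =>
    if toPC z.1 * toPC z.2.1 * toPC z.2.2 = toPC p
      then s.coeff z.1 * t.coeff z.2.1 * u.coeff z.2.2 else 0
  have hex : ∀ q r l : PC, ∀ m : Word × Word, q * r * l = toPC m → ∃ n, q * r = toPC n := by
    intro q r l m h
    rcases hn : q * r with _ | ⟨y, x⟩
    · rw [hn] at h
      exact (PC.pair_ne_zero _ _ h.symm).elim
    · exact ⟨(y, x), rfl⟩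
  have hex' : ∀ q r l : PC, ∀ m : Word × Word, q * (r * l) = toPC m → ∃ n, r * l = toPC n := by
    intro q r l m h
    rcases hn : r * l with _ | ⟨y, x⟩
    · rw [hn] at h
      change q * 0 = _ at h
      rw [mul_zero] at h
      exact (PC.pair_ne_zero _ _ h.symm).elim
    · exact ⟨(y, x), rfl⟩
  -- both sides are the sum of `g` over all triples
  have hL : (s * t * u).coeff p = ∑ᶠ z, g z := by
    let F : ((Word × Word) × (Word × Word)) × ((Word × Word) × (Word × Word)) → K := fun z =>
      if toPC z.1.1 * toPC z.1.2 = toPC p ∧ toPC z.2.1 * toPC z.2.2 = toPC z.1.1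
        then s.coeff z.2.1 * t.coeff z.2.2 * u.coeff z.1.2 else 0
    have hF : (Function.support F).Finite := by
      have hfin := (finite_factorizations (s.finiteToFinite.mulRel t.finiteToFinite)
        u.finiteToFinite p).biUnion fun z _ =>
          (finite_factorizations s.finiteToFinite t.finiteToFinite z.1).image fun w => (z, w)
      refine hfin.subset ?_
      rintro ⟨⟨m, l⟩, ⟨q, r⟩⟩ hz
      rw [Function.mem_support, ne_eq, ite_eq_right_iff, Classical.not_imp] at hz
      obtain ⟨⟨h1, h2⟩, h3⟩ := hz
      have hu := right_ne_zero_of_mul h3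
      have hs := left_ne_zero_of_mul (left_ne_zero_of_mul h3)
      have ht := right_ne_zero_of_mul (left_ne_zero_of_mul h3)
      exact Set.mem_biUnion (x := (m, l)) ⟨⟨q, hs, r, ht, h2⟩, hu, h1⟩
        ⟨(q, r), ⟨hs, ht, h2⟩, rfl⟩
    let e : ((Word × Word) × (Word × Word) × (Word × Word)) × (Word × Word) ≃
        ((Word × Word) × (Word × Word)) × ((Word × Word) × (Word × Word)) :=
      { toFun := fun z => ((z.2, z.1.2.2), (z.1.1, z.1.2.1))
        invFun := fun z => ((z.2.1, z.2.2, z.1.2), z.1.1)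
        left_inv := fun _ => rfl
        right_inv := fun _ => rfl }
    have h1 : (s * t * u).coeff p = ∑ᶠ z, F z := by
      rw [finsum_curry F hF, coeff_mul, mulCoeff]
      refine finsum_congr fun z => ?_
      rw [coeff_mul, mulCoeff, finsum_mul]
      split_ifs with h
      · refine finsum_congr fun w => ?_
        simp only [F, h, true_and, ite_mul, zero_mul]
      · simp only [F, h, false_and, if_false, finsum_zero]
    have hF' : (Function.support fun z => F (e z)).Finite :=
      (hF.preimage e.injective.injOn).subset fun z hz => hz
    rw [h1, ← finsum_comp_equiv e, finsum_curry _ hF']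
    refine finsum_congr fun z => ?_
    by_cases h : toPC z.1 * toPC z.2.1 * toPC z.2.2 = toPC p
    · obtain ⟨n, hn⟩ := hex _ _ _ _ h
      rw [finsum_eq_single _ n]
      · have h' := h
        rw [hn] at h'
        simp only [F, g, e, Equiv.coe_fn_mk, h', hn, and_self, if_true]
      · intro m hm
        simp only [F, e, Equiv.coe_fn_mk]
        exact if_neg fun hc => hm (toPC_injective (hc.2.symm.trans hn))
    · simp only [g, if_neg h]
      refine finsum_eq_zero_of_forall_eq_zero fun m => if_neg ?_
      rintro ⟨h1, h2⟩
      simp only [e, Equiv.coe_fn_mk] at h1 h2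
      exact h (by rw [h2, h1])
  have hR : (s * (t * u)).coeff p = ∑ᶠ z, g z := by
    let F : ((Word × Word) × (Word × Word)) × ((Word × Word) × (Word × Word)) → K := fun z =>
      if toPC z.1.1 * toPC z.1.2 = toPC p ∧ toPC z.2.1 * toPC z.2.2 = toPC z.1.2
        then s.coeff z.1.1 * (t.coeff z.2.1 * u.coeff z.2.2) else 0
    have hF : (Function.support F).Finite := by
      have hfin := (finite_factorizations s.finiteToFinite
        (t.finiteToFinite.mulRel u.finiteToFinite) p).biUnion fun z _ =>
          (finite_factorizations t.finiteToFinite u.finiteToFinite z.2).image fun w => (z, w)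
      refine hfin.subset ?_
      rintro ⟨⟨q, m⟩, ⟨r, l⟩⟩ hz
      rw [Function.mem_support, ne_eq, ite_eq_right_iff, Classical.not_imp] at hz
      obtain ⟨⟨h1, h2⟩, h3⟩ := hz
      have hs := left_ne_zero_of_mul h3
      have ht := left_ne_zero_of_mul (right_ne_zero_of_mul h3)
      have hu := right_ne_zero_of_mul (right_ne_zero_of_mul h3)
      exact Set.mem_biUnion (x := (q, m)) ⟨hs, ⟨r, ht, l, hu, h2⟩, h1⟩
        ⟨(r, l), ⟨ht, hu, h2⟩, rfl⟩
    let e : ((Word × Word) × (Word × Word) × (Word × Word)) × (Word × Word) ≃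
        ((Word × Word) × (Word × Word)) × ((Word × Word) × (Word × Word)) :=
      { toFun := fun z => ((z.1.1, z.2), (z.1.2.1, z.1.2.2))
        invFun := fun z => ((z.1.1, z.2.1, z.2.2), z.1.2)
        left_inv := fun _ => rfl
        right_inv := fun _ => rfl }
    have h1 : (s * (t * u)).coeff p = ∑ᶠ z, F z := by
      rw [finsum_curry F hF, coeff_mul, mulCoeff]
      refine finsum_congr fun z => ?_
      rw [coeff_mul, mulCoeff, mul_finsum]
      split_ifs with h
      · refine finsum_congr fun w => ?_
        simp only [F, h, true_and, mul_ite, mul_zero]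
      · simp only [F, h, false_and, if_false, finsum_zero]
    have hF' : (Function.support fun z => F (e z)).Finite :=
      (hF.preimage e.injective.injOn).subset fun z hz => hz
    rw [h1, ← finsum_comp_equiv e, finsum_curry _ hF']
    refine finsum_congr fun z => ?_
    by_cases h : toPC z.1 * toPC z.2.1 * toPC z.2.2 = toPC p
    · have h' := h
      rw [mul_assoc] at h'
      obtain ⟨n, hn⟩ := hex' _ _ _ _ h'
      rw [finsum_eq_single _ n]
      · rw [hn] at h'
        simp only [F, g, e, Equiv.coe_fn_mk, h', hn, and_self, if_true, mul_assoc]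
      · intro m hm
        simp only [F, e, Equiv.coe_fn_mk]
        exact if_neg fun hc => hm (toPC_injective (hc.2.symm.trans hn))
    · simp only [g, if_neg h]
      refine finsum_eq_zero_of_forall_eq_zero fun m => if_neg ?_
      rintro ⟨h1, h2⟩
      simp only [e, Equiv.coe_fn_mk] at h1 h2
      exact h (by rw [mul_assoc, h2, h1])
  rw [hL, hR]

noncomputable instance : Ring (BInf K) :=
  { (inferInstance : AddCommGroup (BInf K)) with
    mul := (· * ·)
    one := 1
    mul_assoc := mul_assoc'
    one_mul := one_mul'
    mul_one := mul_one'
    left_distrib := left_distrib'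
    right_distrib := right_distrib'
    zero_mul := fun s => by
      have h := right_distrib' 0 0 s
      rw [add_zero] at h
      exact left_eq_add.1 h
    mul_zero := fun s => by
      have h := left_distrib' s 0 0
      rw [add_zero] at h
      exact left_eq_add.1 h }

noncomputable instance : Algebra K (BInf K) := Algebra.ofModule smul_mul' (fun c s t => mul_smul' c s t)

/-- `s` is the formal sum `∑_{i ∈ I} fᵢ`: for each `p`, only finitely many of the `fᵢ` have a nonzero
coefficient at `p`, and the sum of these is the coefficient of `s` at `p`. -/
def IsSum {I : Type*} (f : I → BInf K) (s : BInf K) : Prop :=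
  ∀ p : Word × Word, {i | (f i).coeff p ≠ 0}.Finite ∧ s.coeff p = ∑ᶠ i, (f i).coeff p

open Classical in
/-- `∑_{q ∈ Q} q q⁻¹`. -/
noncomputable def diag (Q : Set Word) : BInf K :=
  ⟨fun p => if p.1 = p.2 ∧ p.1 ∈ Q then 1 else 0, by
    constructor
    · intro v
      refine (Set.finite_singleton v).subset fun u hu => ?_
      have h : v = u ∧ v ∈ Q := by by_contra h; exact hu (if_neg h)
      exact h.1.symm
    · intro u
      refine (Set.finite_singleton u).subset fun v hv => ?_
      have h : v = u ∧ v ∈ Q := by by_contra h; exact hv (if_neg h)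
      exact h.1⟩

theorem isSum_diag (Q : Set Word) : IsSum (fun q : Q => mono q.1 q.1) (diag Q : BInf K) := by
  classical
  intro p
  have hne : ∀ q : Q, (mono q.1 q.1 : BInf K).coeff p ≠ 0 → p = (q.1, q.1) := fun q h => by
    by_contra hp; exact h (if_neg hp)
  refine ⟨Set.Subsingleton.finite fun q hq r hr =>
    Subtype.ext (congrArg Prod.fst ((hne q hq).symm.trans (hne r hr))), ?_⟩
  by_cases h : p.1 = p.2 ∧ p.1 ∈ Q
  · rw [finsum_eq_single _ ⟨p.1, h.2⟩]
    · have hp : p = (p.1, p.1) := Prod.ext rfl h.1.symm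
      rw [coeff_mono, if_pos hp]
      exact if_pos h
    · intro q hq
      by_contra hc
      exact hq (Subtype.ext (congrArg Prod.fst (hne q hc)).symm)
  · rw [finsum_eq_zero_of_forall_eq_zero]
    · exact if_neg h
    · intro q
      by_contra hc
      have hp := hne q hc
      exact h (by rw [hp]; exact ⟨rfl, q.2⟩)

end BInf

/-! ### The algebras `𝒜_∞` and `𝒞_∞ = 𝒜_∞ / I_∞` -/

/-- The set `𝒰_∞^part` of partial unary sums `∑_{i ∈ I} yᵢ xᵢ⁻¹`: both `i ↦ xᵢ` and `i ↦ yᵢ` are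
bijections from the index set `I ⊆ ℕ` onto a prefix code. -/
def UInfPart : Set (BInf K) :=
  {s | ∃ (I : Set ℕ) (x y : I → Word), Function.Injective x ∧ Function.Injective y ∧
    IsPrefixCode (Set.range x) ∧ IsPrefixCode (Set.range y) ∧
    BInf.IsSum (fun i => BInf.mono (y i) (x i)) s}

/-- The set `𝒰_∞` of unary sums: both prefix codes are maximal. -/
def UInf : Set (BInf K) :=
  {s | ∃ (I : Set ℕ) (x y : I → Word), Function.Injective x ∧ Function.Injective y ∧
    IsMaximalPrefixCode (Set.range x) ∧ IsMaximalPrefixCode (Set.range y) ∧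
    BInf.IsSum (fun i => BInf.mono (y i) (x i)) s}

/-- `𝒜_∞`: the subalgebra of `ℬ_∞` generated by `𝒰_∞^part`. -/
noncomputable def AInf : Subalgebra K (BInf K) := Algebra.adjoin K (UInfPart K)

/-- The ideal `I_∞` of `𝒜_∞` generated by the sums `∑_{i ∈ I} yᵢ (∑_{q ∈ Qᵢ} q q⁻¹ - 1) xᵢ⁻¹`, where
`i ↦ xᵢ` and `i ↦ yᵢ` are bijections from `I ⊆ ℕ` onto a maximal prefix code, and all the `Qᵢ` are
maximal prefix codes. -/
noncomputable def IInf : TwoSidedIdeal (AInf K) :=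
  TwoSidedIdeal.span {s | ∃ (I : Set ℕ) (x y : I → Word) (Q : I → Set Word),
    Function.Injective x ∧ Function.Injective y ∧
    IsMaximalPrefixCode (Set.range x) ∧ IsMaximalPrefixCode (Set.range y) ∧
    (∀ i, IsMaximalPrefixCode (Q i)) ∧
    BInf.IsSum (fun i => BInf.mono (y i) [] * (BInf.diag (Q i) - 1) * BInf.mono [] (x i))
      (s : BInf K)}

/-- `𝒞_∞ = 𝒜_∞ / I_∞`. -/
abbrev CInf : Type _ := (IInf K).ringCon.Quotient

/-- `𝒰_∞ / I_∞`: the set of the classes of the elements of `𝒰_∞` in `𝒞_∞`. -/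
def UInfmodIInf : Set (CInf K) := (IInf K).ringCon.mk' '' {s : AInf K | (s : BInf K) ∈ UInf K}

end AlgebraB

end Thompson

namespace Thompson

/-! ### Maximal prefix codes and tables -/

/-! A unary sum is the indicator function of a total table: a set of pairs `(y, x)` forming a
bijection between two maximal prefix codes. Such a table generates an isomorphism between essential
right ideals, hence lies in the graph of exactly one maximal isomorphism `φ`, and it refines `table
φ`, whose inputs are the minimal words of the domain of `φ`. The ideals identify a table with its
refinements, so the class of a unary sum should be the same datum as `φ`.

For `𝒞_∞`: the difference between a total table and a total refinement of it is a generator of `I_∞`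
(`indA_sub_indA_mem`), so the class depends only on `φ`. Already in `ℬ_∞` the product of the sums of
`table φ` and `table ψ` is the sum of the table of the composite (`ind_table_mul`); passing to the
maximal extension then costs one refinement. This gives a homomorphism from `𝒢_{2,1}` onto `𝒰_∞ /
I_∞`. Injectivity needs an invariant. Call `s` vanishing if `w⁻¹ s = 0` for a dense set of words
`w`. The vanishing elements of `𝒜_∞` form a two-sided ideal containing the generators of `I_∞`
(`vanishes_of_mem_IInf`). For a table sum and a word `w` extending an output, `w⁻¹ s` is the inverse
of the preimage of `w`, so two tables of the same class have equal preimages on a dense set, and the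
two maximal isomorphisms coincide.

For `𝒞_V`: there `y x⁻¹` equals the sum of `(y z)(x z)⁻¹` over all `z` of a fixed length, so a
finite unary sum can be rewritten with all inputs of one length `n`. It becomes `levelSum φ n`,
which is independent of large `n` and multiplicative (`levelSum_mul`). Injectivity is inherited from
`𝒞_∞` along a ring homomorphism `𝒞_V → 𝒞_∞`. -/

/-- A word incomparable with all of `C` could be added to `C`. Conversely, an element of a larger
prefix code is comparable with some element of `C`, hence equal to it. -/
theorem isMaximalPrefixCode_iff {C : Set Word} : IsMaximalPrefixCode C ↔
    IsPrefixCode C ∧ ∀ u, ∃ c ∈ C, c <+: u ∨ u <+: c := by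
  constructor
  · rintro ⟨hC, hmax⟩
    refine ⟨hC, fun u => ?_⟩
    by_contra! h
    have hD : IsPrefixCode (insert u C) := by
      rintro v (rfl | hv) w (rfl | hw) hvw
      · rfl
      · exact ((h w hw).2 hvw).elim
      · exact ((h v hv).1 hvw).elim
      · exact hC v hv w hw hvw
    have hu : u ∈ C := by
      rw [hmax _ hD (Set.subset_insert u C)]
      exact Set.mem_insert u C
    exact (h u hu).1 (List.prefix_refl u)
  · rintro ⟨hC, htot⟩
    refine ⟨hC, fun D hD hle => hle.antisymm fun d hd => ?_⟩
    obtain ⟨c, hc, h | h⟩ := htot d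
    · rwa [← hD c (hle hc) d hd h]
    · rwa [hD d hd c (hle hc) h]

/-- A table: a set of pairs `(y, x)` that is a bijection between two prefix codes. -/
structure IsTable (S : Set (Word × Word)) : Prop where
  fst : ∀ p ∈ S, ∀ q ∈ S, p.1 <+: q.1 → p = q
  snd : ∀ p ∈ S, ∀ q ∈ S, p.2 <+: q.2 → p = q

/-- A table between maximal prefix codes. -/
structure IsTotalTable (S : Set (Word × Word)) : Prop extends IsTable S where
  fst_total : ∀ u, ∃ p ∈ S, p.1 <+: u ∨ u <+: p.1
  snd_total : ∀ u, ∃ p ∈ S, p.2 <+: u ∨ u <+: p.2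

theorem IsTable.eq_of_prefix_fst {S : Set (Word × Word)} (hS : IsTable S) {p q : Word × Word}
    (hp : p ∈ S) (hq : q ∈ S) {w : Word} (h : p.1 <+: w) (h' : q.1 <+: w) : p = q := by
  rcases List.prefix_or_prefix_of_prefix h h' with h | h
  · exact hS.fst p hp q hq h
  · exact (hS.fst q hq p hp h).symm

theorem IsTable.eq_of_prefix_snd {S : Set (Word × Word)} (hS : IsTable S) {p q : Word × Word}
    (hp : p ∈ S) (hq : q ∈ S) {w : Word} (h : p.2 <+: w) (h' : q.2 <+: w) : p = q := by
  rcases List.prefix_or_prefix_of_prefix h h' with h | h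
  · exact hS.snd p hp q hq h
  · exact (hS.snd q hq p hp h).symm

theorem IsTable.finiteToFinite {S : Set (Word × Word)} (hS : IsTable S) : FiniteToFinite S :=
  ⟨fun _ => Set.Subsingleton.finite fun _ hx _ hx' =>
      congrArg Prod.snd (hS.fst _ hx _ hx' (List.prefix_refl _)),
    fun _ => Set.Subsingleton.finite fun _ hy _ hy' =>
      congrArg Prod.fst (hS.snd _ hy _ hy' (List.prefix_refl _))⟩

theorem isTable_range {I : Type*} {x y : I → Word} (hx : Function.Injective x)
    (hy : Function.Injective y) (hX : IsPrefixCode (Set.range x))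
    (hY : IsPrefixCode (Set.range y)) : IsTable (Set.range fun i => (y i, x i)) where
  fst := by
    rintro _ ⟨i, rfl⟩ _ ⟨j, rfl⟩ h
    rw [hy (hY _ ⟨i, rfl⟩ _ ⟨j, rfl⟩ h)]
  snd := by
    rintro _ ⟨i, rfl⟩ _ ⟨j, rfl⟩ h
    rw [hx (hX _ ⟨i, rfl⟩ _ ⟨j, rfl⟩ h)]

theorem isTotalTable_range {I : Type*} {x y : I → Word} (hx : Function.Injective x)
    (hy : Function.Injective y) (hX : IsMaximalPrefixCode (Set.range x))
    (hY : IsMaximalPrefixCode (Set.range y)) :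
    IsTotalTable (Set.range fun i => (y i, x i)) where
  toIsTable := isTable_range hx hy hX.1 hY.1
  fst_total u := by
    obtain ⟨_, ⟨i, rfl⟩, h⟩ := (isMaximalPrefixCode_iff.1 hY).2 u
    exact ⟨_, ⟨i, rfl⟩, h⟩
  snd_total u := by
    obtain ⟨_, ⟨i, rfl⟩, h⟩ := (isMaximalPrefixCode_iff.1 hX).2 u
    exact ⟨_, ⟨i, rfl⟩, h⟩

theorem IsTotalTable.of_range {I : Type*} {f : I → Word × Word} (hf : Function.Injective f)
    (hS : IsTotalTable (Set.range f)) :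
    Function.Injective (fun i => (f i).2) ∧ Function.Injective (fun i => (f i).1) ∧
    IsMaximalPrefixCode (Set.range fun i => (f i).2) ∧
    IsMaximalPrefixCode (Set.range fun i => (f i).1) := by
  refine ⟨fun i j h => hf (hS.snd _ ⟨i, rfl⟩ _ ⟨j, rfl⟩ ⟨[], by simpa using h⟩),
    fun i j h => hf (hS.fst _ ⟨i, rfl⟩ _ ⟨j, rfl⟩ ⟨[], by simpa using h⟩),
    isMaximalPrefixCode_iff.2 ⟨?_, fun u => ?_⟩, isMaximalPrefixCode_iff.2 ⟨?_, fun u => ?_⟩⟩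
  · rintro _ ⟨i, rfl⟩ _ ⟨j, rfl⟩ h
    exact congrArg Prod.snd (hS.snd _ ⟨i, rfl⟩ _ ⟨j, rfl⟩ h)
  · obtain ⟨_, ⟨i, rfl⟩, h⟩ := hS.snd_total u
    exact ⟨_, ⟨i, rfl⟩, h⟩
  · rintro _ ⟨i, rfl⟩ _ ⟨j, rfl⟩ h
    exact congrArg Prod.fst (hS.fst _ ⟨i, rfl⟩ _ ⟨j, rfl⟩ h)
  · obtain ⟨_, ⟨i, rfl⟩, h⟩ := hS.fst_total u
    exact ⟨_, ⟨i, rfl⟩, h⟩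

/-! ### The table of a right-ideal isomorphism -/

/-- The table of `φ`: the pairs `(φ x, x)` where `x` belongs to the prefix code of the domain. -/
def table (φ : Word ≃. Word) : Set (Word × Word) :=
  {p | p.1 ∈ φ p.2 ∧ ∀ q ∈ dom φ, q <+: p.2 → q = p.2}

/-- Passing to shorter prefixes in the domain ends at a minimal one, and equivariance restores the
removed suffix. So the table generates the whole graph of `φ`. -/
theorem exists_mem_table {φ : Word ≃. Word} (hφ : IsRightIdealIso φ) {u v : Word}
    (hv : v ∈ φ u) : ∃ p ∈ table φ, ∃ z, v = p.1 ++ z ∧ u = p.2 ++ z := by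
  induction hl : u.length using Nat.strong_induction_on generalizing u v with
  | _ l ih =>
    by_cases hmin : ∀ q ∈ dom φ, q <+: u → q = u
    · exact ⟨(v, u), ⟨hv, hmin⟩, [], by simp⟩
    · push Not at hmin
      obtain ⟨q, ⟨r, hr⟩, ⟨z, rfl⟩, hne⟩ := hmin
      have hzl : 0 < z.length := List.length_pos_iff.2 (by rintro rfl; simp at hne)
      obtain ⟨p, hp, x, rfl, rfl⟩ := ih q.length (by simp at hl; omega) hr rfl
      refine ⟨p, hp, x ++ z, ?_, by simp⟩
      rw [← List.append_assoc]
      exact Option.mem_unique hv (hφ.map_append _ _ hr z)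

/-- The inputs are minimal in the domain, hence a prefix code. For the outputs, `y z = φ x'` with `y
= φ x` forces `x' = x z` by injectivity, and minimality of `x'` makes `z` empty. -/
theorem isTable_table {φ : Word ≃. Word} (hφ : IsRightIdealIso φ) : IsTable (table φ) where
  fst := by
    rintro ⟨_, x⟩ ⟨hp, -⟩ ⟨_, x'⟩ ⟨hq, hmin⟩ ⟨z, rfl⟩
    dsimp only at hp hq hmin
    obtain rfl := φ.inj hq (hφ.map_append _ _ hp z)
    have := hmin x ⟨_, hp⟩ ⟨z, rfl⟩
    obtain rfl : z = [] := by simpa using this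
    simp
  snd := by
    rintro ⟨y, x⟩ ⟨hp, -⟩ ⟨y', x'⟩ ⟨hq, hmin⟩ h
    obtain rfl : x = x' := hmin x ⟨_, hp⟩ h
    exact congrArg (·, x) (Option.mem_unique hp hq)

theorem isTotalTable_table {φ : Word ≃. Word} (hφ : IsEssentialIso φ) :
    IsTotalTable (table φ) where
  toIsTable := isTable_table hφ.toIsRightIdealIso
  fst_total u := by
    obtain ⟨x, w, hw⟩ := hφ.ran_essential.exists_append u
    obtain ⟨p, hp, z, h, -⟩ := exists_mem_table hφ.toIsRightIdealIso hw
    exact ⟨p, hp, List.prefix_or_prefix_of_prefix ⟨z, h.symm⟩ ⟨x, rfl⟩⟩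
  snd_total u := by
    obtain ⟨x, w, hw⟩ := hφ.dom_essential.exists_append u
    obtain ⟨p, hp, z, -, h⟩ := exists_mem_table hφ.toIsRightIdealIso hw
    exact ⟨p, hp, List.prefix_or_prefix_of_prefix ⟨z, h.symm⟩ ⟨x, rfl⟩⟩

/-- A table determines an isomorphism between essential right ideals. -/
theorem IsTotalTable.exists_iso {S : Set (Word × Word)} (hS : IsTotalTable S) :
    ∃ φ : Word ≃. Word, IsEssentialIso φ ∧
      ∀ u v, v ∈ φ u ↔ ∃ p ∈ S, ∃ z, u = p.2 ++ z ∧ v = p.1 ++ z := by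
  classical
  let E : Word → Word → Prop := fun u v => ∃ p ∈ S, ∃ z, u = p.2 ++ z ∧ v = p.1 ++ z
  have hfun : ∀ u v v', E u v → E u v' → v = v' := by
    rintro u v v' ⟨p, hp, z, h, rfl⟩ ⟨q, hq, z', h', rfl⟩
    obtain rfl := hS.eq_of_prefix_snd hp hq ⟨z, h.symm⟩ ⟨z', h'.symm⟩
    rw [List.append_cancel_left (h.symm.trans h')]
  have hinj : ∀ u u' v, E u v → E u' v → u = u' := by
    rintro u u' v ⟨p, hp, z, rfl, h⟩ ⟨q, hq, z', rfl, h'⟩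
    obtain rfl := hS.eq_of_prefix_fst hp hq ⟨z, h.symm⟩ ⟨z', h'.symm⟩
    rw [List.append_cancel_left (h.symm.trans h')]
  -- A single-valued relation is the graph of a partial function; this is applied to `E` and to its
  -- converse.
  have key : ∀ (R : Word → Word → Prop), (∀ u v v', R u v → R u v' → v = v') → ∀ u v,
      (if h : ∃ v, R u v then some h.choose else none) = some v ↔ R u v := by
    intro R hR u v
    by_cases h : ∃ v, R u v
    · rw [dif_pos h, Option.some_inj]
      exact ⟨fun e => e ▸ h.choose_spec, fun e => hR _ _ _ h.choose_spec e⟩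
    · rw [dif_neg h]
      exact ⟨fun e => (Option.some_ne_none _ e.symm).elim, fun e => (h ⟨v, e⟩).elim⟩
  let M : Word ≃. Word :=
    { toFun := fun u => if h : ∃ v, E u v then some h.choose else none
      invFun := fun v => if h : ∃ u, E u v then some h.choose else none
      inv := fun u v => (key (fun v u => E u v) (fun v u u' => hinj u u' v) v u).trans
        (key E hfun u v).symm }
  have hM : ∀ u v, v ∈ M u ↔ E u v := key E hfun
  have hiso : IsRightIdealIso M := isRightIdealIso_of_map_append fun u v hv x => by
    obtain ⟨p, hp, z, rfl, rfl⟩ := (hM u v).1 hv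
    exact (hM _ _).2 ⟨p, hp, z ++ x, by simp, by simp⟩
  refine ⟨M, ⟨hiso, isEssential_of_exists hiso.dom_ideal fun u => ?_,
    isEssential_of_exists hiso.ran_ideal fun u => ?_⟩, hM⟩
  · obtain ⟨p, hp, ⟨z, rfl⟩ | ⟨z, h⟩⟩ := hS.snd_total u
    · exact ⟨[], p.1 ++ z, (hM _ _).2 ⟨p, hp, z, by simp, rfl⟩⟩
    · exact ⟨z, p.1, (hM _ _).2 ⟨p, hp, [], by simp [h], by simp⟩⟩
  · obtain ⟨p, hp, ⟨z, rfl⟩ | ⟨z, h⟩⟩ := hS.fst_total u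
    · exact ⟨[], p.2 ++ z, (hM _ _).2 ⟨p, hp, z, rfl, by simp⟩⟩
    · exact ⟨z, p.2, (hM _ _).2 ⟨p, hp, [], by simp, by simp [h]⟩⟩

/-- Every total table is contained in the graph of a maximal isomorphism. -/
theorem IsTotalTable.exists_maximal {S : Set (Word × Word)} (hS : IsTotalTable S) :
    ∃ φ : G21, ∀ p ∈ S, p.1 ∈ φ.1 p.2 := by
  obtain ⟨χ, hχ, h⟩ := hS.exists_iso
  exact ⟨⟨maxExt χ hχ, maxExt_maximal hχ⟩, fun p hp =>
    le_maxExt hχ _ _ ((h _ _).2 ⟨p, hp, [], by simp, by simp⟩)⟩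

/-! ### Refinement and composition of tables. -/

/-- `S` refines `T`: every row of `S` is an extension of a row of `T`. -/
def Refines (S T : Set (Word × Word)) : Prop :=
  ∀ p ∈ S, ∃ t ∈ T, ∃ z, p.1 = t.1 ++ z ∧ p.2 = t.2 ++ z

theorem refines_table {φ : Word ≃. Word} (hφ : IsRightIdealIso φ) {S : Set (Word × Word)}
    (h : ∀ p ∈ S, p.1 ∈ φ p.2) : Refines S (table φ) :=
  fun p hp => exists_mem_table hφ (h p hp)

/-- A minimal input of the composite passes through a row `(y2, x2)` of `ψ` and a row `(y1, x1)` of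
`φ`, where `y2 z = x1 z'`. If `x1` is a prefix of `y2`, then `x2` already lies in the domain and `z`
is empty; if `x1 = y2 c`, then `x2 c` lies in the domain and `z'` is empty. Either way nothing is
appended to the product of the two rows. -/
theorem exists_factor_of_mem_table {φ ψ : Word ≃. Word} (hφ : IsRightIdealIso φ)
    (hψ : IsRightIdealIso ψ) {p : Word × Word} (hp : p ∈ table (ψ.trans φ)) :
    ∃ q ∈ table φ, ∃ r ∈ table ψ, toPC q * toPC r = toPC p := by
  obtain ⟨y, x⟩ := p
  obtain ⟨hp, hmin⟩ := hp
  dsimp only at hp hmin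
  obtain ⟨m, hm, hy⟩ := (PEquiv.mem_trans _ _ _ _).1 hp
  obtain ⟨⟨y2, x2⟩, hr, z, hz, rfl⟩ := exists_mem_table hψ hm
  obtain ⟨⟨y1, x1⟩, hq, z', rfl, rfl⟩ := exists_mem_table hφ hy
  dsimp only at *
  refine ⟨(y1, x1), hq, (y2, x2), hr, ?_⟩
  have hdom : ∀ c, y2 ++ c ∈ dom φ → x2 ++ c ∈ dom (ψ.trans φ) := fun c ⟨w, hw⟩ =>
    ⟨w, (PEquiv.mem_trans _ _ _ _).2 ⟨_, hψ.map_append _ _ hr.1 c, hw⟩⟩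
  simp only [toPC, PC.pair_mul_pair]
  by_cases h1 : x1 <+: y2
  · rw [if_pos h1]
    obtain ⟨c, rfl⟩ := h1
    have := hmin x2 (by simpa using hdom [] ⟨y1 ++ c, by simpa using hφ.map_append _ _ hq.1 c⟩)
      ⟨z, rfl⟩
    obtain rfl : z = [] := by simpa using this
    rw [List.append_nil] at hz
    obtain rfl := List.append_cancel_left hz
    simp
  · rw [if_neg h1]
    have h2 : y2 <+: x1 := (List.prefix_or_prefix_of_prefix ⟨z', rfl⟩ ⟨z, hz.symm⟩).resolve_left h1
    rw [if_pos h2]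
    obtain ⟨c, rfl⟩ := h2
    rw [List.append_assoc] at hz
    obtain rfl := List.append_cancel_left hz
    have := hmin (x2 ++ c) (hdom c ⟨y1, hq.1⟩) ⟨z', by simp⟩
    obtain rfl : z' = [] := by simpa using this
    simp

/-- The two prefix relations in the conclusion serve `factor_unique`: since outputs of `φ` and
inputs of `ψ` form prefix codes, they recover both factors from the product. -/
theorem mem_table_of_factor {φ ψ : Word ≃. Word} (hφ : IsRightIdealIso φ)
    (hψ : IsRightIdealIso ψ) {p q r : Word × Word} (hq : q ∈ table φ) (hr : r ∈ table ψ)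
    (h : toPC q * toPC r = toPC p) :
    p ∈ table (ψ.trans φ) ∧ q.1 <+: p.1 ∧ r.2 <+: p.2 := by
  obtain ⟨y, x⟩ := p
  obtain ⟨y1, x1⟩ := q
  obtain ⟨y2, x2⟩ := r
  simp only [toPC, PC.pair_mul_pair] at h
  split_ifs at h with h1 h2
  · obtain ⟨c, rfl⟩ := h1
    injection h with e1 e2
    rw [List.drop_left] at e1
    subst e1 e2
    refine ⟨⟨(PEquiv.mem_trans _ _ _ _).2 ⟨_, hr.1, hφ.map_append _ _ hq.1 c⟩, ?_⟩, ⟨c, rfl⟩,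
      List.prefix_refl _⟩
    rintro u ⟨w, hw⟩ hu
    obtain ⟨m, hm, -⟩ := (PEquiv.mem_trans _ _ _ _).1 hw
    exact hr.2 u ⟨m, hm⟩ hu
  · obtain ⟨c, rfl⟩ := h2
    injection h with e1 e2
    rw [List.drop_left] at e2
    subst e1 e2
    refine ⟨⟨(PEquiv.mem_trans _ _ _ _).2 ⟨_, hψ.map_append _ _ hr.1 c, hq.1⟩, ?_⟩,
      List.prefix_refl _, ⟨c, rfl⟩⟩
    rintro u ⟨w, hw⟩ hu
    obtain ⟨m, hm, hw'⟩ := (PEquiv.mem_trans _ _ _ _).1 hw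
    obtain ⟨t, ht, d, rfl, rfl⟩ := exists_mem_table hψ hm
    -- The row of `ψ` below `u` has its input below `x2 c`, so it must be `(y2, x2)`. Minimality of
    -- `y2 c` in the domain of `φ` can then be applied to the image of `u`.
    have := (isTable_table hψ).eq_of_prefix_snd ht hr (List.prefix_append _ _ |>.trans hu)
      (List.prefix_append _ _)
    subst this
    obtain ⟨e, he⟩ := hu
    dsimp only at he
    rw [List.append_assoc] at he
    have he := List.append_cancel_left he
    have := hq.2 _ ⟨w, hw'⟩ ⟨e, by simp [he]⟩
    dsimp only at this ⊢
    rw [List.append_cancel_left this]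

theorem factor_unique {φ ψ : Word ≃. Word} (hφ : IsRightIdealIso φ)
    (hψ : IsRightIdealIso ψ) {p q r q' r' : Word × Word} (hq : q ∈ table φ) (hr : r ∈ table ψ)
    (h : toPC q * toPC r = toPC p) (hq' : q' ∈ table φ) (hr' : r' ∈ table ψ)
    (h' : toPC q' * toPC r' = toPC p) : q = q' ∧ r = r' := by
  obtain ⟨-, h1, h2⟩ := mem_table_of_factor hφ hψ hq hr h
  obtain ⟨-, h3, h4⟩ := mem_table_of_factor hφ hψ hq' hr' h'
  exact ⟨(isTable_table hφ).eq_of_prefix_fst hq hq' h1 h3,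
    (isTable_table hψ).eq_of_prefix_snd hr hr' h2 h4⟩

end Thompson
namespace Thompson

/-! ### Products in `ℬ_∞` -/

namespace BInf

variable {K : Type*} [Field K]

open Classical in
theorem coeff_mono_mul (y x : Word) (s : BInf K) (p : Word × Word) :
    (mono y x * s).coeff p =
      ∑ᶠ r, if PC.pair y x * toPC r = toPC p then s.coeff r else 0 := by
  classical
  rw [coeff_mul, mulCoeff, finsum_curry _ (mulCoeff_finite _ s p), finsum_eq_single _ (y, x)]
  · refine finsum_congr fun r => ?_
    rw [coeff_mono, if_pos rfl, one_mul]
    rfl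
  · intro q hq
    refine finsum_eq_zero_of_forall_eq_zero fun r => ?_
    rw [coeff_mono, if_neg hq, zero_mul, ite_self]

open Classical in
theorem coeff_mul_mono (y x : Word) (s : BInf K) (p : Word × Word) :
    (s * mono y x).coeff p =
      ∑ᶠ r, if toPC r * PC.pair y x = toPC p then s.coeff r else 0 := by
  classical
  rw [coeff_mul, mulCoeff, finsum_curry _ (mulCoeff_finite s _ p)]
  refine finsum_congr fun r => ?_
  rw [finsum_eq_single _ (y, x)]
  · rw [coeff_mono, if_pos rfl, mul_one]
    exact if_congr Iff.rfl rfl rfl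
  · intro q hq
    rw [coeff_mono, if_neg hq, mul_zero, ite_self]

variable (K) in
/-- The inclusion of `PC(a, b)` into `ℬ_∞`. -/
noncomputable def ofPC : PC →*₀ BInf K where
  toFun q := match q with
    | PC.zero => 0
    | PC.pair y x => mono y x
  map_zero' := rfl
  map_one' := rfl
  map_mul' := by
    classical
    have hc : ∀ (q : PC) (p : Word × Word), (match q with
        | PC.zero => 0
        | PC.pair y x => mono y x : BInf K).coeff p = if q = toPC p then 1 else 0 := by
      rintro (_ | ⟨y, x⟩) p
      · exact (if_neg fun h => PC.pair_ne_zero _ _ h.symm).symm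
      · dsimp only
        rw [coeff_mono]
        exact if_congr ⟨fun h => h ▸ rfl, fun h => toPC_injective h.symm⟩ rfl rfl
    rintro (_ | ⟨y, x⟩) q
    · exact (zero_mul _).symm
    rcases q with _ | ⟨v, u⟩
    · exact (mul_zero _).symm
    ext p
    rw [hc]
    dsimp only
    rw [coeff_mono_mul, finsum_eq_single _ (v, u)]
    · rw [coeff_mono, if_pos rfl]
      rfl
    · intro r hr
      rw [coeff_mono, if_neg hr, ite_self]

theorem ofPC_pair (y x : Word) : ofPC K (PC.pair y x) = mono y x := rfl

theorem mono_mul_mono {y x v u t s : Word}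
    (h : PC.pair y x * PC.pair v u = PC.pair t s) : (mono y x * mono v u : BInf K) = mono t s := by
  rw [← ofPC_pair, ← ofPC_pair, ← map_mul, h, ofPC_pair]

theorem mono_mul_mono_cancel (y x u : Word) : (mono y x * mono x u : BInf K) = mono y u :=
  mono_mul_mono (by simp [PC.pair_mul_pair])

theorem mono_inv_mul (z w : Word) : (mono [] z * mono [] w : BInf K) = mono [] (w ++ z) :=
  mono_mul_mono (by
    simp only [PC.pair_mul_pair, List.nil_append, List.length_nil, List.drop_zero,
      List.nil_prefix, if_true]
    split_ifs with h
    · rw [List.prefix_nil.1 h]; simp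
    · rfl)

theorem mono_injective {y x v u : Word} (h : (mono y x : BInf K) = mono v u) :
    y = v ∧ x = u := by
  classical
  have := congrArg (coeff · (y, x)) h
  simp only [coeff_mono, if_true] at this
  by_contra hne
  rw [if_neg (by simpa using hne)] at this
  exact one_ne_zero this

/-! ### Sums over tables. -/

variable (K) in
open Classical in
/-- The sum of the `y x⁻¹` with `(y, x)` in the table `S`. -/
noncomputable def ind (S : Set (Word × Word)) (hS : IsTable S) : BInf K :=
  ⟨fun p => if p ∈ S then 1 else 0,
    hS.finiteToFinite.mono fun p hp => by by_contra h; exact hp (if_neg h)⟩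

open Classical in
theorem coeff_ind {S : Set (Word × Word)} (hS : IsTable S) (p : Word × Word) :
    (ind K S hS).coeff p = if p ∈ S then 1 else 0 := rfl

-- Injectivity of `f` leaves at most one contributing term at each coefficient. Indexed formal sums
-- can thus be traded for indicator functions of sets of pairs.
open Classical in
theorem isSum_mono_iff {I : Type*} {f : I → Word × Word} (hf : Function.Injective f)
    (s : BInf K) : IsSum (fun i => mono (f i).1 (f i).2) s ↔
      ∀ p, s.coeff p = if p ∈ Set.range f then 1 else 0 := by
  refine forall_congr' fun p => ?_
  have hne : ∀ i, (mono (f i).1 (f i).2 : BInf K).coeff p ≠ 0 → f i = p := fun i hi => by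
    by_contra h
    exact hi (if_neg fun e => h e.symm)
  have hfin : {i | (mono (f i).1 (f i).2 : BInf K).coeff p ≠ 0}.Finite :=
    Set.Subsingleton.finite fun i hi j hj => hf ((hne i hi).trans (hne j hj).symm)
  refine (and_iff_right hfin).trans ?_
  dsimp only
  suffices (∑ᶠ i, (mono (f i).1 (f i).2 : BInf K).coeff p) =
      if p ∈ Set.range f then 1 else 0 by rw [this]
  split_ifs with h
  · obtain ⟨i, rfl⟩ := h
    rw [finsum_eq_single _ i]
    · exact if_pos rfl
    · intro j hj
      by_contra hc
      exact hj (hf (hne j hc))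
  · refine finsum_eq_zero_of_forall_eq_zero fun i => ?_
    by_contra hc
    exact h ⟨i, hne i hc⟩

theorem eq_ind_of_isSum {I : Type*} {f : I → Word × Word} (hf : Function.Injective f)
    (hS : IsTable (Set.range f)) {s : BInf K}
    (h : IsSum (fun i => mono (f i).1 (f i).2) s) : s = ind K _ hS := by
  classical
  ext p
  rw [(isSum_mono_iff hf s).1 h p, coeff_ind]

/-- Supplies the index set in `ℕ` that the definitions of the unary sums and of `I_∞` require. -/
theorem exists_nat_index {T : Type*} [Countable T] (S : Set T) :
    ∃ (I : Set ℕ) (f : I → T), Function.Injective f ∧ Set.range f = S := by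
  obtain ⟨g, hg⟩ := exists_injective_nat S
  let e := (Equiv.ofInjective g hg).symm
  refine ⟨Set.range g, fun i => (e i).1, Subtype.val_injective.comp e.injective, ?_⟩
  change Set.range (Subtype.val ∘ e) = S
  rw [Set.range_comp, e.range_eq_univ, Set.image_univ, Subtype.range_coe]

instance : Countable Letter := Finite.to_countable

theorem isSum_ind {I : Type*} {f : I → Word × Word} (hf : Function.Injective f)
    (hS : IsTable (Set.range f)) : IsSum (fun i => mono (f i).1 (f i).2) (ind K _ hS) := by
  classical
  exact (isSum_mono_iff hf _).2 fun p => coeff_ind hS p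

theorem ind_mem_UInf {S : Set (Word × Word)} (hS : IsTotalTable S) :
    ind K S hS.toIsTable ∈ UInf K := by
  obtain ⟨I, f, hf, rfl⟩ := exists_nat_index S
  obtain ⟨h1, h2, h3, h4⟩ := hS.of_range hf
  exact ⟨I, fun i => (f i).2, fun i => (f i).1, h1, h2, h3, h4, isSum_ind hf _⟩

theorem exists_table_of_mem_UInf {s : BInf K} (h : s ∈ UInf K) :
    ∃ S, ∃ hS : IsTotalTable S, s = ind K S hS.toIsTable := by
  obtain ⟨I, x, y, hx, hy, hX, hY, h⟩ := h
  exact ⟨_, isTotalTable_range hx hy hX hY,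
    eq_ind_of_isSum (f := fun i => (y i, x i)) (fun i j e => hx (congrArg Prod.snd e)) _ h⟩

theorem exists_table_of_mem_UInfPart {s : BInf K} (h : s ∈ UInfPart K) :
    ∃ S, ∃ hS : IsTable S, s = ind K S hS := by
  obtain ⟨I, x, y, hx, hy, hX, hY, h⟩ := h
  exact ⟨_, isTable_range hx hy hX hY,
    eq_ind_of_isSum (f := fun i => (y i, x i)) (fun i j e => hx (congrArg Prod.snd e)) _ h⟩

theorem UInf_subset_AInf {s : BInf K} (h : s ∈ UInf K) : s ∈ AInf K := by
  obtain ⟨I, x, y, hx, hy, hX, hY, h⟩ := h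
  exact Algebra.subset_adjoin ⟨I, x, y, hx, hy, hX.1, hY.1, h⟩

/-- A single row is a table, so `y x⁻¹` is a partial unary sum. This lets `PC(a, b)` map into `𝒜_∞`.
-/
theorem mono_mem_AInf (y x : Word) : mono y x ∈ AInf K := by
  refine Algebra.subset_adjoin ⟨{0}, fun _ => x, fun _ => y, Function.injective_of_subsingleton _,
    Function.injective_of_subsingleton _, ?_, ?_, ?_⟩
  · rintro _ ⟨_, rfl⟩ _ ⟨_, rfl⟩ _; rfl
  · rintro _ ⟨_, rfl⟩ _ ⟨_, rfl⟩ _; rfl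
  · exact fun p => ⟨Set.toFinite _, (finsum_unique (α := ({0} : Set ℕ)) fun _ => (mono y x : BInf K).coeff p).symm⟩

/-- The coefficient of the product at `p` counts the factorizations of `p` into a row of `φ` and a
row of `ψ`: exactly one for a row of the composite, none otherwise. The equality holds before
passing to the quotient because the right side uses the composite and not its maximal extension. -/
theorem ind_table_mul {φ ψ : Word ≃. Word} (hφ : IsRightIdealIso φ) (hψ : IsRightIdealIso ψ)
    (hχ : IsRightIdealIso (ψ.trans φ)) :
    ind K _ (isTable_table hφ) * ind K _ (isTable_table hψ) = ind K _ (isTable_table hχ) := by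
  classical
  ext p
  rw [coeff_mul, mulCoeff, coeff_ind]
  split_ifs with h
  · obtain ⟨q, hq, r, hr, he⟩ := exists_factor_of_mem_table hφ hψ h
    rw [finsum_eq_single _ (q, r)]
    · rw [if_pos he, coeff_ind, coeff_ind, if_pos hq, if_pos hr, one_mul]
    · rintro ⟨q', r'⟩ hne
      rw [ite_eq_right_iff]
      intro he'
      by_contra hc
      have hq' : q' ∈ table φ := by
        by_contra hn
        exact left_ne_zero_of_mul hc (if_neg hn)
      have hr' : r' ∈ table ψ := by
        by_contra hn
        exact right_ne_zero_of_mul hc (if_neg hn)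
      obtain ⟨rfl, rfl⟩ := factor_unique hφ hψ hq hr he hq' hr' he'
      exact hne rfl
  · refine finsum_eq_zero_of_forall_eq_zero fun ⟨q', r'⟩ => ?_
    rw [ite_eq_right_iff]
    intro he'
    by_contra hc
    have hq' : q' ∈ table φ := by
      by_contra hn
      exact left_ne_zero_of_mul hc (if_neg hn)
    have hr' : r' ∈ table ψ := by
      by_contra hn
      exact right_ne_zero_of_mul hc (if_neg hn)
    exact h (mem_table_of_factor hφ hψ hq' hr' he').1

/-! ### Multiplication of tables by words -/

/-- Since the outputs form a prefix code, only the row `p` survives multiplication by `(p.1 z)⁻¹`.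
The product is the inverse of the preimage of `p.1 z`, which is how a map is recovered from its sum.
-/
theorem inv_word_mul_ind {S : Set (Word × Word)} (hS : IsTable S) {p : Word × Word}
    (hp : p ∈ S) (z : Word) : mono [] (p.1 ++ z) * ind K S hS = mono [] (p.2 ++ z) := by
  classical
  have hpp : PC.pair [] (p.1 ++ z) * toPC p = PC.pair [] (p.2 ++ z) := by
    rw [toPC, PC.pair_mul_pair]
    split_ifs with h h'
    · obtain rfl : z = [] := by simpa using h.length_le
      simp
    · simp
    · exact (h' ⟨z, rfl⟩).elim
  ext q
  rw [coeff_mono_mul, finsum_eq_single _ p]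
  · rw [hpp, coeff_ind, if_pos hp, coeff_mono]
    exact if_congr ⟨fun h => (toPC_injective (a₁ := (_, _)) h).symm, fun h => h ▸ rfl⟩ rfl rfl
  · intro r hr
    rw [ite_eq_right_iff]
    intro h
    rw [coeff_ind, if_neg]
    intro hrS
    rw [toPC, PC.pair_mul_pair] at h
    split_ifs at h with h1 h2
    · exact hr (hS.fst p hp r hrS ((List.prefix_append _ _).trans h1)).symm
    · exact hr (hS.eq_of_prefix_fst hrS hp h2 (List.prefix_append _ _))
    · exact PC.pair_ne_zero _ _ h.symm

theorem inv_word_mul_ind_eq_zero {S : Set (Word × Word)} (hS : IsTable S) {w : Word}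
    (hw : ∀ p ∈ S, ¬ p.1 <+: w ∧ ¬ w <+: p.1) : mono [] w * ind K S hS = 0 := by
  classical
  ext q
  rw [coeff_mono_mul]
  refine finsum_eq_zero_of_forall_eq_zero fun r => ?_
  rw [ite_eq_right_iff]
  intro h
  rw [coeff_ind, if_neg]
  intro hrS
  rw [toPC, PC.pair_mul_pair, if_neg (hw r hrS).2, if_neg (hw r hrS).1] at h
  exact PC.pair_ne_zero _ _ h.symm

/-- Multiplying a row by `y` on the left never gives zero and only prepends `y` to the output, so
one term contributes. With its right-hand counterpart this computes the coefficients of `y s x⁻¹`.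
-/
theorem coeff_word_mul_append (y : Word) (s : BInf K) (v u : Word) :
    (mono y [] * s).coeff (y ++ v, u) = s.coeff (v, u) := by
  classical
  have h : ∀ r, PC.pair y [] * toPC r = toPC (y ++ r.1, r.2) := fun r => by
    simp [toPC, PC.pair_mul_pair]
  rw [coeff_mono_mul, finsum_eq_single _ (v, u)]
  · rw [h, if_pos rfl]
  · intro r hr
    refine if_neg fun e => hr ?_
    have := toPC_injective ((h r).symm.trans e)
    simpa [Prod.ext_iff] using this

theorem coeff_word_mul_of_not_prefix {y : Word} (s : BInf K) {p : Word × Word}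
    (hp : ¬ y <+: p.1) : (mono y [] * s).coeff p = 0 := by
  classical
  rw [coeff_mono_mul]
  refine finsum_eq_zero_of_forall_eq_zero fun r => if_neg fun e => hp ?_
  rw [toPC, PC.pair_mul_pair, if_pos List.nil_prefix] at e
  rw [← toPC_injective (a₁ := (_, _)) e]
  exact List.prefix_append _ _

theorem coeff_mul_inv_append (x : Word) (s : BInf K) (v u : Word) :
    (s * mono [] x).coeff (v, x ++ u) = s.coeff (v, u) := by
  classical
  have h : ∀ r, toPC r * PC.pair [] x = toPC (r.1, x ++ r.2) := fun r => by
    rw [toPC, ← PC.word_mul_wordInv, mul_assoc]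
    change _ * (_ * PC.wordInv x) = _
    rw [← PC.wordInv_append, PC.word_mul_wordInv, toPC]
  rw [coeff_mul_mono, finsum_eq_single _ (v, u)]
  · rw [h, if_pos rfl]
  · intro r hr
    refine if_neg fun e => hr ?_
    have := toPC_injective ((h r).symm.trans e)
    simpa [Prod.ext_iff] using this

theorem coeff_mul_inv_of_not_prefix {x : Word} (s : BInf K) {p : Word × Word}
    (hp : ¬ x <+: p.2) : (s * mono [] x).coeff p = 0 := by
  classical
  rw [coeff_mul_mono]
  refine finsum_eq_zero_of_forall_eq_zero fun r => if_neg fun e => hp ?_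
  rw [toPC, ← PC.word_mul_wordInv, mul_assoc] at e
  change _ * (_ * PC.wordInv x) = _ at e
  rw [← PC.wordInv_append, PC.word_mul_wordInv] at e
  rw [← toPC_injective (a₁ := (r.1, x ++ r.2)) e]
  exact List.prefix_append _ _

/-! ### Coefficients of the generators of `I_∞`. -/

open Classical in
theorem coeff_diag (Q : Set Word) (p : Word × Word) :
    (diag Q : BInf K).coeff p = if p.1 = p.2 ∧ p.1 ∈ Q then 1 else 0 := rfl

-- The term of a generator at the row `(y, x)` thus trades this row for its extensions by the words
-- of `Q`.
open Classical in
theorem coeff_word_mul_diag_mul (y x : Word) (Q : Set Word) (p : Word × Word) :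
    (mono y [] * diag Q * mono [] x : BInf K).coeff p =
      if ∃ q ∈ Q, p = (y ++ q, x ++ q) then 1 else 0 := by
  obtain ⟨v, u⟩ := p
  by_cases hx : x <+: u
  · obtain ⟨u, rfl⟩ := hx
    rw [coeff_mul_inv_append]
    by_cases hy : y <+: v
    · obtain ⟨v, rfl⟩ := hy
      rw [coeff_word_mul_append, coeff_diag]
      refine if_congr ⟨fun ⟨h1, h2⟩ => ⟨v, h2, ?_⟩, ?_⟩ rfl rfl
      · dsimp only at h1
        rw [h1]
      · rintro ⟨q, hq, e⟩
        simp only [Prod.mk.injEq, List.append_cancel_left_eq] at e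
        obtain ⟨rfl, rfl⟩ := e
        exact ⟨rfl, hq⟩
    · rw [coeff_word_mul_of_not_prefix _ hy, if_neg]
      rintro ⟨q, hq, e⟩
      exact hy ⟨q, (congrArg Prod.fst e).symm⟩
  · rw [coeff_mul_inv_of_not_prefix _ hx, if_neg]
    rintro ⟨q, hq, e⟩
    exact hx ⟨q, (congrArg Prod.snd e).symm⟩

theorem word_mul_sub_one_mul (y x : Word) (s : BInf K) :
    mono y [] * (s - 1) * mono [] x = mono y [] * s * mono [] x - mono y x := by
  rw [mul_sub, sub_mul, mul_one, mono_mul_mono_cancel]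

end BInf

end Thompson
namespace Thompson

/-! ### The generators of `I_∞` -/

namespace BInf

variable {K : Type*} [Field K]

theorem IsSum.unique {I : Type*} {f : I → BInf K} {s t : BInf K} (hs : IsSum f s)
    (ht : IsSum f t) : s = t :=
  ext fun p => (hs p).2.trans (ht p).2.symm

/-- If `S` refines the table `T`, then `∑_S y x⁻¹ - ∑_T y x⁻¹` is the sum of the
`y (∑_{q ∈ Q} q q⁻¹ - 1) x⁻¹` for `(y, x)` in `T`. -/
theorem isSum_ind_sub_ind {I : Type*} {f : I → Word × Word} (hf : Function.Injective f)
    (hT : IsTable (Set.range f)) {S : Set (Word × Word)} (hS : IsTable S)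
    (hST : Refines S (Set.range f)) :
    IsSum (fun i => mono (f i).1 [] * (diag {q | ((f i).1 ++ q, (f i).2 ++ q) ∈ S} - 1) *
      mono [] (f i).2) (ind K S hS - ind K _ hT) := by
  classical
  have hterm : ∀ i p, (mono (f i).1 [] * (diag {q | ((f i).1 ++ q, (f i).2 ++ q) ∈ S} - 1) *
      mono [] (f i).2 : BInf K).coeff p =
      (if p ∈ S ∧ ∃ q, p = ((f i).1 ++ q, (f i).2 ++ q) then 1 else 0) -
        if p = f i then 1 else 0 := by
    intro i p
    rw [word_mul_sub_one_mul, coeff_sub, coeff_word_mul_diag_mul, coeff_mono]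
    refine congrArg₂ _ (if_congr ⟨?_, ?_⟩ rfl rfl) rfl
    · rintro ⟨q, hq, rfl⟩
      exact ⟨hq, q, rfl⟩
    · rintro ⟨hp, q, rfl⟩
      exact ⟨q, hp, rfl⟩
  -- A term contributes at `p` only if its output is a prefix of `p.1`. The outputs of a table form
  -- a prefix code, so at most one term does.
  have hpre : ∀ i p, (mono (f i).1 [] * (diag {q | ((f i).1 ++ q, (f i).2 ++ q) ∈ S} - 1) *
      mono [] (f i).2 : BInf K).coeff p ≠ 0 → (f i).1 <+: p.1 := by
    intro i p h
    rw [hterm] at h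
    by_contra hc
    rw [if_neg, if_neg, sub_zero] at h
    · exact h rfl
    · rintro rfl
      exact hc (List.prefix_refl _)
    · rintro ⟨-, q, rfl⟩
      exact hc (List.prefix_append _ _)
  intro p
  refine ⟨Set.Subsingleton.finite fun i hi j hj => hf
    (hT.eq_of_prefix_fst ⟨i, rfl⟩ ⟨j, rfl⟩ (hpre i p hi) (hpre j p hj)), ?_⟩
  rw [coeff_sub, coeff_ind, coeff_ind]
  -- Refinement enters here: no row of `S` is missed by the terms of the sum.
  have hex : p ∈ S ∨ p ∈ Set.range f → ∃ i q, p = ((f i).1 ++ q, (f i).2 ++ q) := by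
    rintro (h | ⟨i, rfl⟩)
    · obtain ⟨_, ⟨i, rfl⟩, z, h1, h2⟩ := hST p h
      exact ⟨i, z, Prod.ext h1 h2⟩
    · exact ⟨i, [], by simp⟩
  by_cases hp : p ∈ S ∨ p ∈ Set.range f
  · obtain ⟨i, q, hq⟩ := hex hp
    have hi : (f i).1 <+: p.1 := by rw [hq]; exact List.prefix_append _ _
    rw [finsum_eq_single _ i, hterm]
    · refine congrArg₂ _ (if_congr ?_ rfl rfl) (if_congr ?_ rfl rfl)
      · exact ⟨fun h => ⟨h, q, hq⟩, fun h => h.1⟩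
      · refine ⟨?_, fun h => ⟨i, h.symm⟩⟩
        rintro ⟨j, rfl⟩
        exact hT.eq_of_prefix_fst ⟨j, rfl⟩ ⟨i, rfl⟩ (List.prefix_refl _) hi
    · intro j hj
      by_contra hc
      exact hj (hf (hT.eq_of_prefix_fst ⟨j, rfl⟩ ⟨i, rfl⟩ (hpre j p hc) hi))
  · rw [not_or] at hp
    rw [if_neg hp.1, if_neg hp.2, sub_zero]
    refine (finsum_eq_zero_of_forall_eq_zero fun i => ?_).symm
    rw [hterm, if_neg fun h => hp.1 h.1, if_neg fun h => hp.2 ⟨i, h.symm⟩, sub_zero]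

/-- A partial sum with a total table, as an element of `𝒜_∞`. -/
noncomputable def indA (K : Type*) [Field K] (S : Set (Word × Word)) (hS : IsTotalTable S) :
    AInf K :=
  ⟨ind K S hS.toIsTable, UInf_subset_AInf (ind_mem_UInf hS)⟩

/-- Some row of `S` has an output comparable with `t.1 u`. It extends a row of `T`, which can only
be `t` since the outputs of `T` form a prefix code; cancelling `t.1` leaves a suffix comparable with
`u`. -/
theorem isMaximalPrefixCode_of_refines {S T : Set (Word × Word)} (hS : IsTotalTable S)
    (hT : IsTable T) (hST : Refines S T) {t : Word × Word} (ht : t ∈ T) :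
    IsMaximalPrefixCode {q | (t.1 ++ q, t.2 ++ q) ∈ S} := by
  refine isMaximalPrefixCode_iff.2 ⟨fun q hq r hr h => ?_, fun u => ?_⟩
  · have := hS.fst _ hq _ hr ((List.prefix_append_right_inj _).2 h)
    simpa using this
  · obtain ⟨p, hp, h⟩ := hS.fst_total (t.1 ++ u)
    obtain ⟨t', ht', q, h1, h2⟩ := hST p hp
    have htt : t' = t := by
      rcases h with h | h
      · exact hT.eq_of_prefix_fst ht' ht ((h1 ▸ List.prefix_append _ _ : t'.1 <+: p.1).trans h)
          (List.prefix_append _ _)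
      · exact hT.eq_of_prefix_fst ht' ht (h1 ▸ List.prefix_append _ _)
          ((List.prefix_append _ _).trans h)
    subst htt
    refine ⟨q, ?_, ?_⟩
    · change (_, _) ∈ S
      rwa [← h1, ← h2]
    · rwa [h1, List.prefix_append_right_inj, List.prefix_append_right_inj] at h

/-- The difference is itself a generator, with `Q i` the set of suffixes that extend row `i` of `T`
to a row of `S`. -/
theorem indA_sub_indA_mem {S T : Set (Word × Word)} (hS : IsTotalTable S) (hT : IsTotalTable T)
    (hST : Refines S T) : indA K S hS - indA K T hT ∈ IInf K := by
  obtain ⟨I, f, hf, rfl⟩ := exists_nat_index T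
  obtain ⟨h1, h2, h3, h4⟩ := hT.of_range hf
  exact TwoSidedIdeal.subset_span ⟨I, fun i => (f i).2, fun i => (f i).1, _, h1, h2, h3, h4,
    fun i => isMaximalPrefixCode_of_refines hS hT.toIsTable hST ⟨i, rfl⟩,
    isSum_ind_sub_ind hf hT.toIsTable hS.toIsTable hST⟩

theorem isTotalTable_of_refinement {I : Type*} {f : I → Word × Word}
    (hT : IsTotalTable (Set.range f)) {Q : I → Set Word} (hf : Function.Injective f)
    (hQ : ∀ i, IsMaximalPrefixCode (Q i)) :
    IsTotalTable {p | ∃ i, ∃ q ∈ Q i, p = ((f i).1 ++ q, (f i).2 ++ q)} where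
  fst := by
    rintro _ ⟨i, q, hq, rfl⟩ _ ⟨j, r, hr, rfl⟩ h
    obtain rfl := hf (hT.eq_of_prefix_fst ⟨i, rfl⟩ ⟨j, rfl⟩ ((List.prefix_append _ _).trans h)
      (List.prefix_append _ _))
    rw [(hQ i).1 q hq r hr ((List.prefix_append_right_inj _).1 h)]
  snd := by
    rintro _ ⟨i, q, hq, rfl⟩ _ ⟨j, r, hr, rfl⟩ h
    obtain rfl := hf (hT.eq_of_prefix_snd ⟨i, rfl⟩ ⟨j, rfl⟩ ((List.prefix_append _ _).trans h)
      (List.prefix_append _ _))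
    rw [(hQ i).1 q hq r hr ((List.prefix_append_right_inj _).1 h)]
  fst_total u := by
    obtain ⟨_, ⟨i, rfl⟩, ⟨r, rfl⟩ | h⟩ := hT.fst_total u
    · obtain ⟨q, hq, h⟩ := (isMaximalPrefixCode_iff.1 (hQ i)).2 r
      refine ⟨_, ⟨i, q, hq, rfl⟩, ?_⟩
      rwa [List.prefix_append_right_inj, List.prefix_append_right_inj]
    -- Comparability with the empty word only serves to produce an element of `Q i`.
    · obtain ⟨q, hq, -⟩ := (isMaximalPrefixCode_iff.1 (hQ i)).2 []
      exact ⟨_, ⟨i, q, hq, rfl⟩, Or.inr (h.trans (List.prefix_append _ _))⟩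
  snd_total u := by
    obtain ⟨_, ⟨i, rfl⟩, ⟨r, rfl⟩ | h⟩ := hT.snd_total u
    · obtain ⟨q, hq, h⟩ := (isMaximalPrefixCode_iff.1 (hQ i)).2 r
      refine ⟨_, ⟨i, q, hq, rfl⟩, ?_⟩
      rwa [List.prefix_append_right_inj, List.prefix_append_right_inj]
    · obtain ⟨q, hq, -⟩ := (isMaximalPrefixCode_iff.1 (hQ i)).2 []
      exact ⟨_, ⟨i, q, hq, rfl⟩, Or.inr (h.trans (List.prefix_append _ _))⟩

/-- Every generator of `I_∞` is the difference of a table and one of its refinements. -/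
theorem exists_tables_of_generator {I : Set ℕ} {x y : I → Word} {Q : I → Set Word}
    (hx : Function.Injective x) (hy : Function.Injective y)
    (hX : IsMaximalPrefixCode (Set.range x)) (hY : IsMaximalPrefixCode (Set.range y))
    (hQ : ∀ i, IsMaximalPrefixCode (Q i)) {s : BInf K}
    (hs : IsSum (fun i => mono (y i) [] * (diag (Q i) - 1) * mono [] (x i)) s) :
    ∃ S T, ∃ (hS : IsTotalTable S) (hT : IsTotalTable T), Refines S T ∧
      s = ind K S hS.toIsTable - ind K T hT.toIsTable := by
  have hf : Function.Injective fun i => (y i, x i) := fun i j e => hx (congrArg Prod.snd e)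
  have hT := isTotalTable_range hx hy hX hY
  have hS := isTotalTable_of_refinement hT hf hQ
  have hST : Refines {p | ∃ i, ∃ q ∈ Q i, p = (y i ++ q, x i ++ q)}
      (Set.range fun i => (y i, x i)) := by
    rintro _ ⟨i, q, hq, rfl⟩
    exact ⟨_, ⟨i, rfl⟩, q, rfl, rfl⟩
  refine ⟨_, _, hS, hT, hST, hs.unique ?_⟩
  have := isSum_ind_sub_ind (K := K) hf hT.toIsTable hS.toIsTable hST
  -- It remains to see that the suffixes cut out at row `i` by the refined table are exactly those
  -- in `Q i`: a suffix coming from another row `j` is excluded because the outputs form a prefix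
  -- code.
  convert this using 6 with i
  ext q
  refine ⟨fun hq => ⟨i, q, hq, rfl⟩, ?_⟩
  rintro ⟨j, r, hr, e⟩
  obtain rfl : i = j := hf (hT.eq_of_prefix_fst ⟨i, rfl⟩ ⟨j, rfl⟩
    (w := y i ++ q) (List.prefix_append _ _) (by
      rw [show y i ++ q = y j ++ r from congrArg Prod.fst e]; exact List.prefix_append _ _))
  simp only [Prod.mk.injEq, List.append_cancel_left_eq] at e
  rw [e.1]
  exact hr

/-! ### The elements of `𝒜_∞` that vanish almost everywhere -/

/-- `s` vanishes almost everywhere: for the words `w` of an essential right ideal, `w⁻¹ s = 0`. -/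
def Vanishes (s : BInf K) : Prop := ∀ u : Word, ∃ x : Word, mono [] (u ++ x) * s = 0

/-- As `(w z)⁻¹ = z⁻¹ w⁻¹`, the words `w` with `w⁻¹ s = 0` form a right ideal. This is why two such
dense sets still meet densely in `Vanishes.add`. -/
theorem mono_append_mul_eq_zero {s : BInf K} {w : Word} (h : mono [] w * s = 0) (z : Word) :
    mono [] (w ++ z) * s = 0 := by
  rw [← mono_inv_mul, mul_assoc, h, mul_zero]

theorem Vanishes.zero : Vanishes (0 : BInf K) := fun _ => ⟨[], mul_zero _⟩

theorem Vanishes.add {s t : BInf K} (hs : Vanishes s) (ht : Vanishes t) : Vanishes (s + t) := by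
  intro u
  obtain ⟨x, hx⟩ := hs u
  obtain ⟨z, hz⟩ := ht (u ++ x)
  refine ⟨x ++ z, ?_⟩
  rw [← List.append_assoc, mul_add, hz, mono_append_mul_eq_zero hx, add_zero]

theorem Vanishes.neg {s : BInf K} (hs : Vanishes s) : Vanishes (-s) := by
  intro u
  obtain ⟨x, hx⟩ := hs u
  exact ⟨x, by rw [mul_neg, hx, neg_zero]⟩

theorem Vanishes.mul_right {s : BInf K} (hs : Vanishes s) (t : BInf K) : Vanishes (s * t) := by
  intro u
  obtain ⟨x, hx⟩ := hs u
  exact ⟨x, by rw [← mul_assoc, hx, zero_mul]⟩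

/-- A word `u` incomparable with all outputs gives `u⁻¹ · ind S = 0`. Otherwise `u` extends to some
`p.1 z`, and `(p.1 z)⁻¹ · ind S = (p.2 z)⁻¹`, so the vanishing of `s` near `p.2 z` can be used. -/
theorem Vanishes.ind_mul {s : BInf K} (hs : Vanishes s) {S : Set (Word × Word)}
    (hS : IsTable S) : Vanishes (ind K S hS * s) := by
  intro u
  by_cases h : ∀ p ∈ S, ¬ p.1 <+: u ∧ ¬ u <+: p.1
  · exact ⟨[], by rw [← mul_assoc, List.append_nil, inv_word_mul_ind_eq_zero hS h, zero_mul]⟩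
  · have hex : ∃ p ∈ S, ∃ x z, u ++ x = p.1 ++ z := by
      push Not at h
      obtain ⟨p, hp, h⟩ := h
      by_cases h1 : p.1 <+: u
      · obtain ⟨z, hz⟩ := h1
        exact ⟨p, hp, [], z, by rw [hz, List.append_nil]⟩
      · obtain ⟨x, hx⟩ := h h1
        exact ⟨p, hp, x, [], by rw [hx, List.append_nil]⟩
    obtain ⟨p, hp, x, z, h⟩ := hex
    obtain ⟨c, hc⟩ := hs (p.2 ++ z)
    refine ⟨x ++ c, ?_⟩
    rw [← List.append_assoc, h, List.append_assoc, ← mul_assoc, inv_word_mul_ind hS hp,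
      ← List.append_assoc, hc]

/-- Here the generation of `𝒜_∞` by table sums is used: tables are covered by `Vanishes.ind_mul`,
and scalars are central. -/
theorem Vanishes.mul_left {s t : BInf K} (ht : t ∈ AInf K) (hs : Vanishes s) :
    Vanishes (t * s) := by
  induction ht using Algebra.adjoin_induction generalizing s with
  | mem t ht =>
    obtain ⟨S, hS, rfl⟩ := exists_table_of_mem_UInfPart ht
    exact hs.ind_mul hS
  | algebraMap c =>
    rw [Algebra.commutes]
    exact hs.mul_right _
  | add t t' _ _ h h' =>
    rw [add_mul]
    exact (h hs).add (h' hs)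
  | mul t t' _ _ h h' =>
    rw [mul_assoc]
    exact h (h' hs)

/-- A word extending an output of `S` has the same preimage under both tables, since a row of `S`
and the row of `T` below it differ by a common suffix. Totality of `S` makes these words dense. -/
theorem vanishes_ind_sub_ind {S T : Set (Word × Word)} (hS : IsTotalTable S) (hT : IsTable T)
    (hST : Refines S T) : Vanishes (ind K S hS.toIsTable - ind K T hT) := by
  have key : ∀ p ∈ S, ∀ z, mono [] (p.1 ++ z) * (ind K S hS.toIsTable - ind K T hT) = 0 := by
    intro p hp z
    obtain ⟨t, ht, c, h1, h2⟩ := hST p hp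
    rw [mul_sub, inv_word_mul_ind _ hp, h1, List.append_assoc, inv_word_mul_ind _ ht, h2,
      List.append_assoc, sub_self]
  intro u
  obtain ⟨p, hp, ⟨z, hz⟩ | ⟨x, hx⟩⟩ := hS.fst_total u
  · exact ⟨[], by rw [List.append_nil, ← hz, key p hp]⟩
  · exact ⟨x, by rw [hx, ← List.append_nil p.1, key p hp]⟩

/-- The vanishing elements of `𝒜_∞` form a two-sided ideal, so only the generators need checking.
This invariant is what separates the classes of different maximal isomorphisms. -/
theorem vanishes_of_mem_IInf {s : AInf K} (hs : s ∈ IInf K) : Vanishes (s : BInf K) := by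
  let J : TwoSidedIdeal (AInf K) := TwoSidedIdeal.mk' {s | Vanishes (s : BInf K)} Vanishes.zero
    Vanishes.add Vanishes.neg (fun {t _} => Vanishes.mul_left t.2)
    fun {_ t} hs => hs.mul_right (t : BInf K)
  have hle : IInf K ≤ J := by
    refine TwoSidedIdeal.span_le.2 ?_
    rintro s ⟨I, x, y, Q, hx, hy, hX, hY, hQ, hs⟩
    obtain ⟨S, T, hS, hT, hST, h⟩ := exists_tables_of_generator hx hy hX hY hQ hs
    change s ∈ J
    rw [TwoSidedIdeal.mem_mk']
    change Vanishes (s : BInf K)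
    rw [h]
    exact vanishes_ind_sub_ind hS hT.toIsTable hST
  exact (TwoSidedIdeal.mem_mk' ..).1 (hle hs)

end BInf

/-! ### The group `𝒰_∞ / I_∞` -/

/-- Two maximal isomorphisms that coincide almost everywhere are equal. -/
theorem G21.eq_of_dense {φ ψ : G21}
    (h : ∀ u : Word, ∃ x v, u ++ x ∈ φ.1 v ∧ u ++ x ∈ ψ.1 v) : φ = ψ := by
  -- The common essential restriction is `φ` followed by `ψ⁻¹` and `ψ`, that is, `φ` restricted to
  -- the words whose image lies in the range of `ψ`.
  refine eq_of_le ((φ.2.toIsEssentialIso.trans ψ.2.symm.toIsEssentialIso).trans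
    ψ.2.toIsEssentialIso) ?_ ?_
  all_goals
    intro u w hw
    obtain ⟨n, hn, hw⟩ := (PEquiv.mem_trans _ _ _ _).1 hw
    obtain ⟨m, hm, hn⟩ := (PEquiv.mem_trans _ _ _ _).1 hn
    rw [PEquiv.mem_iff_mem] at hn
    obtain rfl := Option.mem_unique hn hw
  · exact hm
  -- Some extension `m x` has the same preimage under both maps; by equivariance this preimage is `u
  -- x` and also `n x`, so `u = n`.
  · obtain ⟨x, v, h1, h2⟩ := h m
    have e1 := φ.1.inj h1 (φ.2.map_append _ _ hm x)
    have e2 := ψ.1.inj h2 (ψ.2.map_append _ _ hn x)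
    rwa [eq_of_append_eq (e1.symm.trans e2)]

variable {K : Type*} [Field K]

theorem G21.eq_of_vanishes {φ ψ : G21} {S T : Set (Word × Word)} (hS : IsTotalTable S)
    (hT : IsTotalTable T) (hSφ : ∀ p ∈ S, p.1 ∈ φ.1 p.2) (hTψ : ∀ p ∈ T, p.1 ∈ ψ.1 p.2)
    (h : BInf.Vanishes (BInf.ind K S hS.toIsTable - BInf.ind K T hT.toIsTable)) : φ = ψ := by
  have hex : ∀ {S : Set (Word × Word)}, IsTotalTable S → ∀ u, ∃ p ∈ S, ∃ x z, u ++ x = p.1 ++ z := by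
    intro S hS u
    obtain ⟨p, hp, ⟨z, hz⟩ | ⟨x, hx⟩⟩ := hS.fst_total u
    · exact ⟨p, hp, [], z, by simp [hz]⟩
    · exact ⟨p, hp, x, [], by simp [hx]⟩
  refine eq_of_dense fun u => ?_
  -- The word is extended three times: above an output of `S`, above an output of `T`, and into the
  -- set where the difference is killed. There both tables yield the same inverse word.
  obtain ⟨p, hp, x, z, h1⟩ := hex hS u
  obtain ⟨q, hq, x', z', h2⟩ := hex hT (u ++ x)
  obtain ⟨x'', h3⟩ := h (u ++ x ++ x')
  have e1 : u ++ x ++ x' ++ x'' = p.1 ++ (z ++ x' ++ x'') := by simp [h1]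
  have e2 : u ++ x ++ x' ++ x'' = q.1 ++ (z' ++ x'') := by simp [h2]
  rw [mul_sub, sub_eq_zero] at h3
  nth_rw 1 [e1] at h3
  rw [e2, BInf.inv_word_mul_ind _ hp, BInf.inv_word_mul_ind _ hq] at h3
  have e3 := (BInf.mono_injective h3).2
  refine ⟨x ++ x' ++ x'', p.2 ++ (z ++ x' ++ x''), ?_, ?_⟩
  · have := φ.2.map_append _ _ (hSφ p hp) (z ++ x' ++ x'')
    rw [← e1] at this
    simpa using this
  · have := ψ.2.map_append _ _ (hTψ q hq) (z' ++ x'')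
    rw [← e2, ← e3] at this
    simpa using this

/-! ### Classes of tables and the homomorphism from `𝒢_{2,1}`. -/

variable (K) in
/-- The class of a total table in `𝒞_∞`. -/
noncomputable def tableClass (S : Set (Word × Word)) (hS : IsTotalTable S) : CInf K :=
  (IInf K).ringCon.mk' (BInf.indA K S hS)

theorem tableClass_eq_iff {S T : Set (Word × Word)} (hS : IsTotalTable S) (hT : IsTotalTable T) :
    tableClass K S hS = tableClass K T hT ↔ BInf.indA K S hS - BInf.indA K T hT ∈ IInf K := by
  rw [← TwoSidedIdeal.rel_iff]
  exact RingCon.eq _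

theorem G21.eq_of_tableClass_eq {φ ψ : G21} {S T : Set (Word × Word)} (hS : IsTotalTable S)
    (hT : IsTotalTable T) (hSφ : ∀ p ∈ S, p.1 ∈ φ.1 p.2) (hTψ : ∀ p ∈ T, p.1 ∈ ψ.1 p.2)
    (h : tableClass K S hS = tableClass K T hT) : φ = ψ :=
  eq_of_vanishes (K := K) hS hT hSφ hTψ
    (BInf.vanishes_of_mem_IInf ((tableClass_eq_iff hS hT).1 h))

/-- A total table inside the graph of `φ` refines `table φ`, so its class depends on `φ` alone. -/
theorem tableClass_eq_table {S : Set (Word × Word)} (hS : IsTotalTable S) {φ : Word ≃. Word}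
    (hφ : IsEssentialIso φ) (h : ∀ p ∈ S, p.1 ∈ φ p.2) :
    tableClass K S hS = tableClass K _ (isTotalTable_table hφ) :=
  (tableClass_eq_iff _ _).2
    (BInf.indA_sub_indA_mem _ _ (refines_table hφ.toIsRightIdealIso h))

theorem tableClass_table_mul {φ ψ : Word ≃. Word} (hφ : IsEssentialIso φ)
    (hψ : IsEssentialIso ψ) :
    tableClass K _ (isTotalTable_table hφ) * tableClass K _ (isTotalTable_table hψ) =
      tableClass K _ (isTotalTable_table (hψ.trans hφ)) := by
  rw [tableClass, tableClass, ← map_mul]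
  refine congrArg _ (Subtype.ext ?_)
  exact BInf.ind_table_mul hφ.toIsRightIdealIso hψ.toIsRightIdealIso
    (hψ.trans hφ).toIsRightIdealIso

theorem tableClass_table_refl :
    tableClass K _ (isTotalTable_table refl_maximal.toIsEssentialIso) = 1 := by
  classical
  refine (congrArg (IInf K).ringCon.mk' (Subtype.ext ?_)).trans (map_one _)
  ext p
  change (BInf.ind K _ (isTotalTable_table refl_maximal.toIsEssentialIso).toIsTable).coeff p = (BInf.mono [] []).coeff p
  rw [BInf.coeff_ind, BInf.coeff_mono]
  refine if_congr ⟨?_, ?_⟩ rfl rfl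
  · rintro ⟨h, hmin⟩
    have h1 : p.2 = p.1 := by simpa using h
    have h2 := hmin [] ⟨[], rfl⟩ List.nil_prefix
    exact Prod.ext (h1.symm.trans h2.symm) h2.symm
  · rintro rfl
    exact ⟨rfl, fun q _ hq => List.prefix_nil.1 hq⟩

variable (K) in
/-- The homomorphism from `𝒢_{2,1}` to `𝒞_∞`. -/
noncomputable def toCInf : G21 →* CInf K where
  toFun φ := tableClass K _ (isTotalTable_table φ.2.toIsEssentialIso)
  map_one' := tableClass_table_refl
  map_mul' φ ψ := by
    rw [tableClass_table_mul φ.2.toIsEssentialIso ψ.2.toIsEssentialIso]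
    -- The table of the composite lies in the graph of its maximal extension, so both have the same
    -- class.
    exact (tableClass_eq_table _ (φ * ψ).2.toIsEssentialIso fun p hp => G21.comp_le_mul φ ψ _ _ hp.1).symm

theorem toCInf_injective : Function.Injective (toCInf K) := fun _ _ h =>
  G21.eq_of_tableClass_eq (K := K) _ _ (fun _ hp => hp.1) (fun _ hp => hp.1) h

theorem range_toCInf : Set.range (toCInf K) = UInfmodIInf K := by
  ext c
  constructor
  · rintro ⟨φ, rfl⟩
    exact ⟨_, BInf.ind_mem_UInf (isTotalTable_table φ.2.toIsEssentialIso), rfl⟩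
  · rintro ⟨s, hs, rfl⟩
    obtain ⟨S, hS, h⟩ := BInf.exists_table_of_mem_UInf hs
    obtain ⟨φ, hφ⟩ := hS.exists_maximal
    refine ⟨φ, (tableClass_eq_table hS φ.2.toIsEssentialIso hφ).symm.trans ?_⟩
    exact congrArg _ (Subtype.ext h.symm)

/-- The range of an injective homomorphism from a group to a monoid is a group of units. -/
theorem exists_subgroup_units {G M : Type*} [Group G] [Monoid M] (f : G →* M)
    (hf : Function.Injective f) {U : Set M} (hU : Set.range f = U) :
    ∃ H : Subgroup Mˣ, Units.val '' (H : Set Mˣ) = U ∧ Nonempty (G ≃* H) := by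
  have hinj : Function.Injective f.toHomUnits := fun a b h => hf (congrArg Units.val h)
  refine ⟨f.toHomUnits.range, ?_, ⟨MonoidHom.ofInjective hinj⟩⟩
  rw [← hU, MonoidHom.coe_range, ← Set.range_comp]
  rfl

end Thompson
namespace Thompson

/-! ### Words of a given length -/

/-- The words of length `n`. -/
noncomputable def wordsOfLength (n : ℕ) : Finset Word := (List.finite_length_eq Letter n).toFinset

theorem mem_wordsOfLength {n : ℕ} {w : Word} : w ∈ wordsOfLength n ↔ w.length = n := by
  simp [wordsOfLength]

theorem sum_wordsOfLength_zero {M : Type*} [AddCommMonoid M] (f : Word → M) :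
    ∑ w ∈ wordsOfLength 0, f w = f [] := by
  rw [show wordsOfLength 0 = {[]} by ext w; simp [mem_wordsOfLength], Finset.sum_singleton]

theorem sum_letter {M : Type*} [AddCommMonoid M] (f : Letter → M) :
    ∑ α, f α = f Letter.a + f Letter.b :=
  Finset.sum_pair (by decide)

theorem sum_wordsOfLength_succ {M : Type*} [AddCommMonoid M] (f : Word → M) (n : ℕ) :
    ∑ w ∈ wordsOfLength (n + 1), f w =
      ∑ w ∈ wordsOfLength n, (f (w ++ [Letter.a]) + f (w ++ [Letter.b])) := by
  rw [← Finset.sum_congr rfl fun w _ => sum_letter fun α => f (w ++ [α]), Finset.sum_sigma']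
  symm
  refine Finset.sum_bij (fun p _ => p.1 ++ [p.2]) ?_ ?_ ?_ fun _ _ => rfl
  · rintro ⟨w, α⟩ h
    simp only [Finset.mem_sigma, mem_wordsOfLength] at h
    simp [mem_wordsOfLength, h.1]
  · rintro ⟨w, α⟩ - ⟨w', α'⟩ - h
    obtain ⟨rfl, h⟩ := List.append_inj' h rfl
    obtain rfl : α = α' := by simpa using h
    rfl
  · intro w hw
    rw [mem_wordsOfLength] at hw
    have hne : w ≠ [] := by rintro rfl; simp at hw
    refine ⟨⟨w.dropLast, w.getLast hne⟩, ?_, List.dropLast_append_getLast hne⟩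
    simp [mem_wordsOfLength, hw]

/-- A sum over the words of length `n`, grouped by their prefixes in the maximal prefix code on the
right side of a total table. -/
theorem sum_wordsOfLength_eq {M : Type*} [AddCommMonoid M] (f : Word → M) {F : Finset (Word × Word)}
    (hF : IsTotalTable (F : Set (Word × Word))) {n : ℕ} (hn : ∀ p ∈ F, p.2.length ≤ n) :
    ∑ p ∈ F, ∑ z ∈ wordsOfLength (n - p.2.length), f (p.2 ++ z) = ∑ w ∈ wordsOfLength n, f w := by
  rw [Finset.sum_sigma']
  refine Finset.sum_bij (fun p _ => p.1.2 ++ p.2) ?_ ?_ ?_ fun _ _ => rfl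
  · rintro ⟨p, z⟩ h
    simp only [Finset.mem_sigma, mem_wordsOfLength] at h
    have := hn p h.1
    rw [mem_wordsOfLength, List.length_append]
    dsimp only
    omega
  · rintro ⟨p, z⟩ h ⟨p', z'⟩ h' e
    simp only [Finset.mem_sigma] at h h' e
    obtain rfl := hF.eq_of_prefix_snd (w := p.2 ++ z) h.1 h'.1 (List.prefix_append _ _)
      (e ▸ List.prefix_append _ _)
    rw [List.append_cancel_left e]
  · intro w hw
    rw [mem_wordsOfLength] at hw
    obtain ⟨p, hp, h⟩ := hF.snd_total w
    have h' : p.2 <+: w := by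
      refine h.elim id fun h => ?_
      rw [h.eq_of_length_le (by rw [hw]; exact hn p hp)]
    obtain ⟨z, rfl⟩ := h'
    refine ⟨⟨p, z⟩, ?_, rfl⟩
    simp only [Finset.mem_sigma, mem_wordsOfLength]
    rw [List.length_append] at hw
    exact ⟨hp, by omega⟩

/-! ### The algebra `𝒞_V` -/

variable (K : Type*) [Field K]

/-- The homomorphism from `PC(a, b)` to `𝒞_V`. -/
noncomputable def pcToCV : PC →* CV K :=
  (((IV K).ringCon.mk' : KPC K →+* CV K).toMonoidHom.comp
    (RingCon.mk' _ : MonoidAlgebra K PC →+* KPC K).toMonoidHom).comp (MonoidAlgebra.of K PC)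

/-- The class of `y x⁻¹` in `𝒞_V`. -/
noncomputable def cvPair (y x : Word) : CV K := pcToCV K (PC.pair y x)

theorem mk_kpair (y x : Word) : (IV K).ringCon.mk' (kpair K y x) = cvPair K y x := rfl

/-- `pcToCV` is built as a monoid homomorphism only; that it respects zero comes from the
identification of the two zeros in `K[PC(a, b)]`. -/
theorem pcToCV_zero : pcToCV K 0 = 0 := by
  have h : (RingCon.mk' _ (MonoidAlgebra.single (0 : PC) (1 : K)) : KPC K) = 0 :=
    (RingCon.eq _).2 (TwoSidedIdeal.subset_span rfl)
  exact (congrArg (IV K).ringCon.mk' h).trans (map_zero _)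

variable {K}

theorem cvPair_nil : cvPair K [] [] = 1 := map_one (pcToCV K)

theorem cvPair_mul_append (y x z u : Word) :
    cvPair K y x * cvPair K (x ++ z) u = cvPair K (y ++ z) u := by
  rw [cvPair, cvPair, ← map_mul, PC.pair_mul_pair, if_pos (List.prefix_append _ _), List.drop_left]
  rfl

theorem cvPair_mul_eq_zero {y x v u : Word} (h : ¬ x <+: v) (h' : ¬ v <+: x) :
    cvPair K y x * cvPair K v u = 0 := by
  rw [cvPair, cvPair, ← map_mul, PC.pair_mul_pair, if_neg h, if_neg h', pcToCV_zero]

theorem cvPair_mul_inv (y x u : Word) :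
    cvPair K y x * cvPair K [] u = cvPair K y (u ++ x) := by
  rw [cvPair, cvPair, ← map_mul, ← PC.word_mul_wordInv, mul_assoc]
  change pcToCV K (_ * (_ * PC.wordInv u)) = _
  rw [← PC.wordInv_append, PC.word_mul_wordInv, cvPair]

theorem cvPair_letters :
    cvPair K [Letter.a] [Letter.a] + cvPair K [Letter.b] [Letter.b] = cvPair K [] [] := by
  have h : (IV K).ringCon.mk'
      (kpair K [Letter.a] [Letter.a] + kpair K [Letter.b] [Letter.b] - 1) = 0 :=
    (RingCon.eq _).2 (TwoSidedIdeal.subset_span rfl)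
  rwa [map_sub, map_add, map_one, sub_eq_zero, mk_kpair, mk_kpair, ← cvPair_nil] at h

/-- This is the relation `a a⁻¹ + b b⁻¹ = 1` multiplied by `y` on the left and by `x⁻¹` on the
right. Iterated, it brings the inputs of a finite table to a common length. -/
theorem cvPair_eq_add (y x : Word) : cvPair K y x =
    cvPair K (y ++ [Letter.a]) (x ++ [Letter.a]) +
      cvPair K (y ++ [Letter.b]) (x ++ [Letter.b]) := by
  have key : ∀ z, cvPair K y [] * cvPair K z z * cvPair K [] x = cvPair K (y ++ z) (x ++ z) :=
    fun z => by rw [← List.nil_append z, cvPair_mul_append, cvPair_mul_inv, List.nil_append]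
  rw [← key, ← key, ← add_mul, ← mul_add, cvPair_letters, key, List.append_nil,
    List.append_nil]

theorem cvPair_eq_sum (y x : Word) (n : ℕ) :
    cvPair K y x = ∑ z ∈ wordsOfLength n, cvPair K (y ++ z) (x ++ z) := by
  induction n with
  | zero => rw [sum_wordsOfLength_zero, List.append_nil, List.append_nil]
  | succ n ih =>
    rw [ih, sum_wordsOfLength_succ]
    refine Finset.sum_congr rfl fun z _ => ?_
    rw [cvPair_eq_add]
    simp only [List.append_assoc]

/-! ### The elements of `V` as sums over the words of length `n` -/

/-- The value of `φ`, or the empty word outside the domain. -/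
def value (φ : Word ≃. Word) (w : Word) : Word := (φ w).getD []

theorem value_eq {φ : Word ≃. Word} {u v : Word} (h : v ∈ φ u) : value φ u = v := by
  rw [value, Option.mem_def.1 h, Option.getD_some]

theorem value_mem {φ : Word ≃. Word} {u : Word} (h : u ∈ dom φ) : value φ u ∈ φ u := by
  obtain ⟨v, hv⟩ := h
  rwa [value_eq hv]

/-- `φ` is defined on all words of length at least `n`. -/
def DefinedFrom (φ : Word ≃. Word) (n : ℕ) : Prop := ∀ w : Word, n ≤ w.length → w ∈ dom φ

theorem DefinedFrom.mono {φ : Word ≃. Word} {m n : ℕ} (h : DefinedFrom φ m) (hmn : m ≤ n) :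
    DefinedFrom φ n := fun w hw => h w (hmn.trans hw)

open Classical in
/-- The table of the restriction of `φ` to the words of length at least `n`. -/
noncomputable def levelTable (φ : Word ≃. Word) (n : ℕ) : Finset (Word × Word) :=
  (wordsOfLength n).image fun w => (value φ w, w)

theorem mem_levelTable {φ : Word ≃. Word} {n : ℕ} {p : Word × Word} :
    p ∈ levelTable φ n ↔ p.2.length = n ∧ p.1 = value φ p.2 := by
  classical
  simp only [levelTable, Finset.mem_image, mem_wordsOfLength]
  constructor
  · rintro ⟨w, hw, rfl⟩
    exact ⟨hw, rfl⟩
  · rintro ⟨hw, h⟩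
    exact ⟨p.2, hw, Prod.ext h.symm rfl⟩

theorem mem_of_mem_levelTable {φ : Word ≃. Word} {n : ℕ} (hn : DefinedFrom φ n)
    {p : Word × Word} (hp : p ∈ levelTable φ n) : p.1 ∈ φ p.2 := by
  rw [mem_levelTable] at hp
  rw [hp.2]
  exact value_mem (hn _ hp.1.ge)

theorem sum_levelTable {M : Type*} [AddCommMonoid M] (φ : Word ≃. Word) (n : ℕ)
    (f : Word × Word → M) :
    ∑ p ∈ levelTable φ n, f p = ∑ w ∈ wordsOfLength n, f (value φ w, w) := by
  classical
  exact Finset.sum_image fun w _ w' _ h => congrArg Prod.snd h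

theorem isTotalTable_levelTable {φ : Word ≃. Word} (hφ : IsEssentialIso φ) {n : ℕ}
    (hn : DefinedFrom φ n) : IsTotalTable (levelTable φ n : Set (Word × Word)) where
  fst p hp q hq h := by
    have h1 := mem_of_mem_levelTable hn hp
    have h2 := mem_of_mem_levelTable hn hq
    obtain ⟨z, hz⟩ := h
    have h3 := hφ.map_append _ _ h1 z
    rw [hz] at h3
    have h4 := φ.inj h2 h3
    rw [Finset.mem_coe, mem_levelTable] at hp hq
    have h5 := congrArg List.length h4
    rw [List.length_append, hp.1, hq.1] at h5
    obtain rfl : z = [] := List.length_eq_zero_iff.1 (by omega)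
    rw [List.append_nil] at h4 hz
    exact Prod.ext hz h4.symm
  snd p hp q hq h := by
    rw [Finset.mem_coe, mem_levelTable] at hp hq
    have := h.eq_of_length (hp.1.trans hq.1.symm)
    exact Prod.ext (by rw [hp.2, hq.2, this]) this
  fst_total u := by
    obtain ⟨x, v, hv⟩ := hφ.ran_essential.exists_append u
    -- The preimage `v` may be shorter than `n`. Padding it makes its prefix of length `n`
    -- available, and the value of that prefix lies below `u x z`, hence is comparable with `u`.
    let z : Word := List.replicate n Letter.a
    have hlen : n ≤ (v ++ z).length := by simp [z]
    have hw : ((v ++ z).take n).length = n := by rw [List.length_take]; omega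
    have h1 := hφ.map_append _ _ hv z
    have h2 := hφ.map_append _ _ (value_mem (hn _ hw.ge)) ((v ++ z).drop n)
    rw [List.take_append_drop] at h2
    refine ⟨(value φ ((v ++ z).take n), (v ++ z).take n), mem_levelTable.2 ⟨hw, rfl⟩, ?_⟩
    refine List.prefix_or_prefix_of_prefix (l₃ := u ++ x ++ z) ?_ ⟨x ++ z, by simp⟩
    rw [Option.mem_unique h1 h2]
    exact List.prefix_append _ _
  snd_total u := by
    rcases le_total n u.length with h | h
    · refine ⟨(value φ (u.take n), u.take n), mem_levelTable.2 ⟨?_, rfl⟩,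
        Or.inl (List.take_prefix n u)⟩
      rw [List.length_take]
      omega
    · refine ⟨(value φ (u ++ List.replicate (n - u.length) Letter.a), _),
        mem_levelTable.2 ⟨?_, rfl⟩, Or.inr (List.prefix_append _ _)⟩
      simp only [List.length_append, List.length_replicate]
      omega

variable (K) in
/-- `∑_{|w| = n} φ(w) w⁻¹` in `𝒞_V`. -/
noncomputable def levelSum (φ : Word ≃. Word) (n : ℕ) : CV K :=
  ∑ w ∈ wordsOfLength n, cvPair K (value φ w) w

/-- Each row is expanded until its inputs have length `n`. By totality the extended inputs run
exactly once through the words of length `n`, and by equivariance the extended outputs are their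
values. -/
theorem sum_cvPair_eq_levelSum {φ : Word ≃. Word} (hφ : IsRightIdealIso φ)
    {F : Finset (Word × Word)} (hF : IsTotalTable (F : Set (Word × Word)))
    (h : ∀ p ∈ F, p.1 ∈ φ p.2) {n : ℕ} (hn : ∀ p ∈ F, p.2.length ≤ n) :
    ∑ p ∈ F, cvPair K p.1 p.2 = levelSum K φ n := by
  rw [levelSum, ← sum_wordsOfLength_eq _ hF hn]
  refine Finset.sum_congr rfl fun p hp => ?_
  rw [cvPair_eq_sum p.1 p.2 (n - p.2.length)]
  refine Finset.sum_congr rfl fun z _ => ?_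
  rw [value_eq (hφ.map_append _ _ (h p hp) z)]

theorem levelSum_eq_of_le {φ : Word ≃. Word} (hφ : IsEssentialIso φ) {m n : ℕ}
    (hm : DefinedFrom φ m) (hmn : m ≤ n) : levelSum K φ m = levelSum K φ n := by
  rw [← sum_cvPair_eq_levelSum hφ.toIsRightIdealIso (isTotalTable_levelTable hφ hm)
    (fun _ => mem_of_mem_levelTable hm) fun p hp => (mem_levelTable.1 hp).1.trans_le hmn,
    sum_levelTable]
  rfl

theorem levelSum_eq {φ : Word ≃. Word} (hφ : IsEssentialIso φ) {m n : ℕ}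
    (hm : DefinedFrom φ m) (hn : DefinedFrom φ n) : levelSum K φ m = levelSum K φ n :=
  (levelSum_eq_of_le hφ hm (le_max_left m n)).trans
    (levelSum_eq_of_le hφ hn (le_max_right m n)).symm

theorem levelSum_refl_zero : levelSum K (PEquiv.refl Word) 0 = 1 := by
  rw [levelSum, sum_wordsOfLength_zero, value_eq (v := []) rfl, cvPair_nil]

/-- The level `n + m` for `ψ` ensures that each output `ψ w` has length at least `m`. Exactly one
word of length `m` is a prefix of `ψ w`, so in the product one term of the sum for `φ` survives for
each `w`. -/
theorem levelSum_mul {φ ψ χ : Word ≃. Word} (hφ : IsRightIdealIso φ) (hψ : IsRightIdealIso ψ)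
    (hχ : ψ.trans φ ≤ χ) {m n : ℕ} (hm : DefinedFrom φ m) (hn : DefinedFrom ψ n) :
    DefinedFrom χ (n + m) ∧ levelSum K φ m * levelSum K ψ (n + m) = levelSum K χ (n + m) := by
  have key : ∀ w : Word, n + m ≤ w.length → ∃ v₀ z y, v₀.length = m ∧ v₀ ++ z ∈ ψ w ∧
      y ∈ φ v₀ ∧ y ++ z ∈ χ w := by
    intro w hw
    have hv := value_mem (hn w (by omega))
    -- Write `w = w' w''` with `w'` of length `n`: then `ψ w = ψ(w') w''`, and `w''` has length at
    -- least `m`.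
    have hlen : m ≤ (value ψ w).length := by
      have h1 := hψ.map_append _ _ (value_mem (hn (w.take n) (by rw [List.length_take]; omega)))
        (w.drop n)
      rw [List.take_append_drop] at h1
      rw [value_eq h1, List.length_append, List.length_drop]
      omega
    have hl : ((value ψ w).take m).length = m := by rw [List.length_take]; omega
    obtain ⟨y, hy⟩ := hm _ hl.ge
    have h2 := hφ.map_append _ _ hy ((value ψ w).drop m)
    rw [← List.take_append_drop m (value ψ w)] at hv
    exact ⟨_, _, y, hl, hv, hy, hχ _ _ ((PEquiv.mem_trans _ _ _ _).2 ⟨_, hv, h2⟩)⟩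
  refine ⟨fun w hw => ?_, ?_⟩
  · obtain ⟨_, _, y, -, -, -, h⟩ := key w hw
    exact ⟨_, h⟩
  · rw [levelSum, levelSum, Finset.sum_mul_sum, Finset.sum_comm]
    refine Finset.sum_congr rfl fun w hw => ?_
    obtain ⟨v₀, z, y, hl, h1, h2, h3⟩ := key w (mem_wordsOfLength.1 hw).ge
    rw [value_eq h1, value_eq h3, Finset.sum_eq_single v₀, value_eq h2, cvPair_mul_append]
    · intro v hv hne
      rw [mem_wordsOfLength] at hv
      have hpre : ∀ c : Word, ¬ (v <+: c ∧ v₀ <+: c) := fun c ⟨h, h'⟩ => hne <| by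
        rcases List.prefix_or_prefix_of_prefix h h' with h | h
        · exact h.eq_of_length (hv.trans hl.symm)
        · exact (h.eq_of_length (hl.trans hv.symm)).symm
      exact cvPair_mul_eq_zero (fun h => hpre _ ⟨h, List.prefix_append _ _⟩)
        fun h => hpre _ ⟨List.prefix_refl _, (List.prefix_append _ _).trans h⟩
    · exact fun h => (h (mem_wordsOfLength.2 hl)).elim

theorem V.exists_definedFrom (φ : V) : ∃ n, DefinedFrom φ.1.1 n :=
  (isFinGen_iff φ.1.2.dom_essential).1 φ.2.1

theorem V.isEssentialIso (φ : V) : IsEssentialIso φ.1.1 := φ.1.2.toIsEssentialIso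

variable (K) in
/-- The image of `φ` in `𝒞_V`. -/
noncomputable def vSum (φ : V) : CV K := levelSum K φ.1.1 (V.exists_definedFrom φ).choose

theorem vSum_eq (φ : V) {n : ℕ} (hn : DefinedFrom φ.1.1 n) : vSum K φ = levelSum K φ.1.1 n :=
  levelSum_eq (V.isEssentialIso φ) (V.exists_definedFrom φ).choose_spec hn

variable (K) in
/-- The homomorphism from `V` to `𝒞_V`. -/
noncomputable def toCV : V →* CV K where
  toFun := vSum K
  map_one' := by
    rw [vSum_eq 1 (n := 0) fun w _ => ⟨w, rfl⟩]
    exact levelSum_refl_zero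
  map_mul' φ ψ := by
    obtain ⟨m, hm⟩ := V.exists_definedFrom φ
    obtain ⟨n, hn⟩ := V.exists_definedFrom ψ
    obtain ⟨h1, h2⟩ := levelSum_mul (K := K) (V.isEssentialIso φ).toIsRightIdealIso
      (V.isEssentialIso ψ).toIsRightIdealIso (G21.comp_le_mul φ.1 ψ.1) hm hn
    rw [vSum_eq φ hm, vSum_eq ψ (hn.mono (Nat.le_add_right n m)), h2]
    exact vSum_eq (φ * ψ) h1

/-! ### The group `𝒰_V / I_V` -/

theorem sum_cvPair_mem_UVmodIV {F : Finset (Word × Word)}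
    (hF : IsTotalTable (F : Set (Word × Word))) : ∑ p ∈ F, cvPair K p.1 p.2 ∈ UVmodIV K := by
  let e : Finset.range F.card ≃ F := Finset.equivOfCardEq (Finset.card_range _)
  have hf : Function.Injective fun i => (e i).1 := Subtype.val_injective.comp e.injective
  have hr : Set.range (fun i => (e i).1) = (F : Set (Word × Word)) := by
    change Set.range (Subtype.val ∘ e) = _
    rw [Set.range_comp, e.range_eq_univ, Set.image_univ, Subtype.range_coe]
  obtain ⟨h1, h2, h3, h4⟩ := IsTotalTable.of_range hf (by rw [hr]; exact hF)
  refine ⟨_, ⟨Finset.range F.card, fun i => (e i).1.2, fun i => (e i).1.1, h1, h2, h3, h4, rfl⟩, ?_⟩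
  rw [map_sum, ← Finset.sum_coe_sort F fun p => cvPair K p.1 p.2]
  exact e.sum_comp fun p => cvPair K p.1.1 p.1.2

theorem exists_finset_of_mem_UVmodIV {c : CV K} (hc : c ∈ UVmodIV K) :
    ∃ F : Finset (Word × Word), IsTotalTable (F : Set (Word × Word)) ∧
      c = ∑ p ∈ F, cvPair K p.1 p.2 := by
  classical
  obtain ⟨_, ⟨I, x, y, hx, hy, hX, hY, rfl⟩, rfl⟩ := hc
  have hS := isTotalTable_range hx hy hX hY
  refine ⟨Finset.univ.image fun i => (y i, x i), ?_, ?_⟩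
  · rw [Finset.coe_image, Finset.coe_univ, Set.image_univ]
    exact hS
  · rw [Finset.sum_image fun i _ j _ h => hx (congrArg Prod.snd h), map_sum]
    rfl

theorem exists_length_le (F : Finset (Word × Word)) :
    ∃ n, ∀ p ∈ F, p.1.length ≤ n ∧ p.2.length ≤ n :=
  ⟨F.sup fun p => max p.1.length p.2.length, fun _ hp =>
    max_le_iff.1 (Finset.le_sup (f := fun p : Word × Word => max p.1.length p.2.length) hp)⟩

/-- A word at least as long as all words of `F` extends whatever row it is comparable with. So
domain and range contain all long words, which is finite generation by `isFinGen_iff`. -/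
theorem exists_V_of_finset {F : Finset (Word × Word)}
    (hF : IsTotalTable (F : Set (Word × Word))) : ∃ φ : V, ∀ p ∈ F, p.1 ∈ φ.1.1 p.2 := by
  obtain ⟨φ, hφ⟩ := hF.exists_maximal
  obtain ⟨n, hn⟩ := exists_length_le F
  refine ⟨⟨φ, (isFinGen_iff φ.2.dom_essential).2 ⟨n, fun u hu => ?_⟩,
    (isFinGen_iff φ.2.ran_essential).2 ⟨n, fun u hu => ?_⟩⟩, hφ⟩
  · obtain ⟨p, hp, h⟩ := hF.snd_total u
    have h' : p.2 <+: u := h.elim id fun h =>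
      (h.eq_of_length_le ((hn p hp).2.trans hu)) ▸ List.prefix_refl _
    obtain ⟨z, rfl⟩ := h'
    exact ⟨_, φ.2.map_append _ _ (hφ p hp) z⟩
  · obtain ⟨p, hp, h⟩ := hF.fst_total u
    have h' : p.1 <+: u := h.elim id fun h =>
      (h.eq_of_length_le ((hn p hp).1.trans hu)) ▸ List.prefix_refl _
    obtain ⟨z, rfl⟩ := h'
    exact ⟨_, φ.2.map_append _ _ (hφ p hp) z⟩

theorem range_toCV : Set.range (toCV K) = UVmodIV K := by
  ext c
  constructor
  · rintro ⟨φ, rfl⟩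
    have h := (V.exists_definedFrom φ).choose_spec
    change levelSum K _ _ ∈ _
    rw [levelSum, ← sum_levelTable _ _ fun p : Word × Word => cvPair K p.1 p.2]
    exact sum_cvPair_mem_UVmodIV (isTotalTable_levelTable (V.isEssentialIso φ) h)
  · intro hc
    obtain ⟨F, hF, rfl⟩ := exists_finset_of_mem_UVmodIV hc
    obtain ⟨φ, hφ⟩ := exists_V_of_finset hF
    obtain ⟨m, hm⟩ := V.exists_definedFrom φ
    obtain ⟨n, hn⟩ := exists_length_le F
    -- The level must reach both the words where `φ` is defined and the inputs of `F`, hence the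
    -- maximum.
    refine ⟨φ, (vSum_eq φ (hm.mono (le_max_left m n))).trans ?_⟩
    exact (sum_cvPair_eq_levelSum (V.isEssentialIso φ).toIsRightIdealIso hF hφ fun p hp =>
      (hn p hp).2.trans (le_max_right m n)).symm

/-! ### The homomorphism from `𝒞_V` to `𝒞_∞` -/

variable (K) in
/-- The inclusion of `PC(a, b)` into `𝒜_∞`. -/
noncomputable def pcToAInf : PC →* AInf K :=
  (BInf.ofPC K : PC →* BInf K).codRestrict (AInf K) (by
    rintro (_ | ⟨y, x⟩)
    · exact zero_mem _
    · exact BInf.mono_mem_AInf y x)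

theorem sum_pcToAInf {F : Finset (Word × Word)} (hF : IsTotalTable (F : Set (Word × Word))) :
    ∑ p ∈ F, pcToAInf K (PC.pair p.1 p.2) = BInf.indA K F hF := by
  classical
  let coeffHom (q : Word × Word) : BInf K →+ K := ⟨⟨(BInf.coeff · q), rfl⟩, fun _ _ => rfl⟩
  refine Subtype.ext ?_
  rw [AddSubmonoidClass.coe_finsetSum]
  ext q
  change coeffHom q (∑ p ∈ F, BInf.mono p.1 p.2) = (BInf.ind K _ hF.toIsTable).coeff q
  rw [map_sum, BInf.coeff_ind]
  refine (Finset.sum_congr rfl fun p _ => ?_).trans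
    ((Finset.sum_ite_eq F q fun _ => (1 : K)).trans (by by_cases hq : q ∈ F <;> simp [hq]))
  exact if_congr Iff.rfl rfl rfl

/-- Used twice to factor a homomorphism through a quotient with one relator: the zero of the monoid,
then `a a⁻¹ + b b⁻¹ - 1`. -/
theorem ringCon_span_le_ker {R S : Type*} [Ring R] [Ring S] (f : R →+* S) (r : R) (h : f r = 0) :
    (TwoSidedIdeal.span {r}).ringCon ≤ RingCon.ker f := by
  have hle : TwoSidedIdeal.span {r} ≤ TwoSidedIdeal.ker f :=
    TwoSidedIdeal.span_le.2 (by rintro _ rfl; exact (TwoSidedIdeal.mem_ker f).2 h)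
  intro x y hxy
  have := (TwoSidedIdeal.mem_ker f).1 (hle ((TwoSidedIdeal.rel_iff _ x y).1 hxy))
  rw [map_sub, sub_eq_zero] at this
  exact this

variable (K) in
/-- The homomorphism from `K[PC(a, b)]` to `𝒞_∞`. -/
noncomputable def kpcToCInf : KPC K →+* CInf K :=
  RingCon.lift _ ((IInf K).ringCon.mk'.comp
    (MonoidAlgebra.lift K (AInf K) PC (pcToAInf K)).toRingHom)
    (ringCon_span_le_ker _ _ (by
      refine (congrArg (IInf K).ringCon.mk' ?_).trans (map_zero _)
      refine (MonoidAlgebra.lift_single _ _ _).trans ?_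
      rw [one_smul]
      rfl))

theorem kpcToCInf_kpair (y x : Word) :
    kpcToCInf K (kpair K y x) = (IInf K).ringCon.mk' (pcToAInf K (PC.pair y x)) := by
  refine congrArg (IInf K).ringCon.mk' ((MonoidAlgebra.lift_single _ _ _).trans ?_)
  rw [one_smul]

theorem sum_kpcToCInf {F : Finset (Word × Word)} (hF : IsTotalTable (F : Set (Word × Word))) :
    ∑ p ∈ F, kpcToCInf K (kpair K p.1 p.2) = tableClass K F hF := by
  simp_rw [kpcToCInf_kpair]
  rw [← map_sum, sum_pcToAInf hF]
  rfl

/-- The rows `(a, a)` and `(b, b)` form the table of the identity at level `1`, whose class in `𝒞_∞`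
is `1`. -/
theorem kpcToCInf_letters : kpcToCInf K
    (kpair K [Letter.a] [Letter.a] + kpair K [Letter.b] [Letter.b] - 1) = 0 := by
  have hd : DefinedFrom (PEquiv.refl Word) 1 := fun w _ => ⟨w, rfl⟩
  have hS := isTotalTable_levelTable refl_maximal.toIsEssentialIso hd
  have h := sum_kpcToCInf (K := K) hS
  have hv : ∀ w, value (PEquiv.refl Word) w = w := fun w => value_eq rfl
  rw [tableClass_eq_table hS refl_maximal.toIsEssentialIso fun _ => mem_of_mem_levelTable hd,
    tableClass_table_refl, sum_levelTable, sum_wordsOfLength_succ, sum_wordsOfLength_zero] at h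
  simp only [hv, List.nil_append] at h
  rw [map_sub, map_add, h, map_one, sub_self]

variable (K) in
/-- The homomorphism from `𝒞_V` to `𝒞_∞`. -/
noncomputable def cvToCInf : CV K →+* CInf K :=
  RingCon.lift _ (kpcToCInf K) (ringCon_span_le_ker _ _ kpcToCInf_letters)

theorem cvToCInf_levelSum {φ : Word ≃. Word} (hφ : IsEssentialIso φ) {n : ℕ}
    (hn : DefinedFrom φ n) :
    cvToCInf K (levelSum K φ n) = tableClass K _ (isTotalTable_levelTable hφ hn) := by
  rw [levelSum, ← sum_levelTable _ _ fun p : Word × Word => cvPair K p.1 p.2, map_sum,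
    ← sum_kpcToCInf]
  rfl

/-- In `𝒞_∞` the images become the classes of level tables, which determine the maximal
isomorphisms; no separate invariant on `𝒞_V` is needed. -/
theorem toCV_injective : Function.Injective (toCV K) := by
  intro φ ψ h
  have hφ := (V.exists_definedFrom φ).choose_spec
  have hψ := (V.exists_definedFrom ψ).choose_spec
  have h' := congrArg (cvToCInf K) h
  change cvToCInf K (levelSum K _ _) = cvToCInf K (levelSum K _ _) at h'
  rw [cvToCInf_levelSum (V.isEssentialIso φ) hφ, cvToCInf_levelSum (V.isEssentialIso ψ) hψ] at h'
  exact Subtype.ext (G21.eq_of_tableClass_eq (K := K) _ _ (fun _ => mem_of_mem_levelTable hφ)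
    (fun _ => mem_of_mem_levelTable hψ) h')

end Thompson

/-! ### The theorem. -/

theorem mainTheorem3 (K : Type*) [Field K] :
    (∃ H : Subgroup (Thompson.CV K)ˣ,
      Units.val '' (H : Set (Thompson.CV K)ˣ) = Thompson.UVmodIV K ∧
        Nonempty (Thompson.V ≃* H)) ∧
    (∃ H : Subgroup (Thompson.CInf K)ˣ,
      Units.val '' (H : Set (Thompson.CInf K)ˣ) = Thompson.UInfmodIInf K ∧
        Nonempty (Thompson.G21 ≃* H)) :=
  ⟨Thompson.exists_subgroup_units (Thompson.toCV K) Thompson.toCV_injective Thompson.range_toCV,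
    Thompson.exists_subgroup_units (Thompson.toCInf K) Thompson.toCInf_injective
      Thompson.range_toCInf⟩
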